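/- Let $N\ge 3$, let $\Omega\subset\mathbb R^N$ be a bounded domain, let $h\in L^p(\Omega)$ for some $p>N/2$, and let $H:\Omega\times\mathbb R\times\mathbb R^N\to\mathbb R$ be a Carathéodory function. Assume: (L) $Lu=\sum_{i,j}\partial_{x_j}\big(a^{ij}(x)\,\partial_{x_i}u\big)$ with $a^{ij}\in L^\infty(\Omega)\cap W^{1,\infty}_{loc}(\Omega)$ for $1\le i,j\le N$, and there is $\eta>0$ such that $\sum_{i,j}a^{ij}(x)\xi_i\xi_j\ge\eta|\xi|^2$ for a.e. $x\in\Omega$ and all $\xi\in\mathbb R^N$; (H2) there are $b_2\in L^N_{loc}(\Omega)$ and a continuous function $C_2:[0,\infty)\times[0,\infty)\to\mathbb R$ such that, for a.e. $x\in\Omega$, all $s_1\ge s_2$ in $\mathbb R$ and all $\xi_1,\xi_2\in\mathbb R^N$, $$H(x,s_1,\xi_1)-H(x,s_2,\xi_2)\le C_2(|s_1|,|s_2|)\,\big(|\xi_1|+|\xi_2|+b_2(x)\big)\,|\xi_1-\xi_2| .$$ A function $u$ is a lower solution of $$-Lu=H(x,u,\nabla u)+h(x)\ \text{ in }\Omega,\qquad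 u=0\ \text{ on }\partial\Omega,$$ if $u^+\in H^1_0(\Omega)$ and, for all $\varphi\in H^1_0(\Omega)\cap L^\infty(\Omega)$ with $\varphi\ge0$ a.e. in $\Omega$, the function $H(x,u,\nabla u)\varphi$ is integrable on $\Omega$ and $$\sum_{i,j=1}^N\int_\Omega a^{ij}\,\frac{\partial u}{\partial x_i}\,\frac{\partial\varphi}{\partial x_j}\,dx\le\int_\Omega H(x,u,\nabla u)\,\varphi\,dx+\int_\Omega h\,\varphi\,dx ;$$ it is an upper solution if $u^-\in H^1_0(\Omega)$ and the same holds with $\ge$ in place of $\le$ in the integral inequality. Let $u_1,u_2\in H^1(\Omega)\cap W^{1,N}_{loc}(\Omega)\cap C(\overline\Omega)$ be respectively a lower solution and an upper solution. Assume moreover that $u_1\le u_2$ on $\partial\Omega$ pointwise, or that $\Omega$ satisfies the following condition (A): there are $r_0,\theta_0>0$ such that, for all $x\in\partial\Omega$ and $0<r<r_0$, every connected component $\Omega_r$ of $\Omega\cap B_r(x)$ satisfies $\operatorname{meas}\Omega_r\le(1-\theta_0)\operatorname{meas}B_r(x)$. Then $u_1\le u_2$ in $\Omega$. -/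

import Mathlib

open MeasureTheory Filter Topology Set
open scoped ENNReal ContDiff

/-- `ℝ^N` with the Euclidean norm. -/
abbrev RN (N : ℕ) : Type := EuclideanSpace ℝ (Fin N)

/-- Test functions: `φ ∈ C_c^∞(Ω)`. -/
structure IsTestFunction {N : ℕ} (Ω : Set (RN N)) (φ : RN N → ℝ) : Prop where
  smooth : ContDiff ℝ ∞ φ
  compact : HasCompactSupport φ
  support : tsupport φ ⊆ Ω

/-- `G` is the weak (distributional) gradient of `u` in the open set `Ω`. -/
structure HasWeakGrad {N : ℕ} (Ω : Set (RN N)) (u : RN N → ℝ) (G : RN N → RN N) : Prop where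
  locInt : LocallyIntegrableOn u Ω
  locIntGrad : LocallyIntegrableOn G Ω
  integral_eq : ∀ φ : RN N → ℝ, IsTestFunction Ω φ → ∀ i : Fin N,
    ∫ x in Ω, u x * fderiv ℝ φ x (EuclideanSpace.single i 1) = - ∫ x in Ω, G x i * φ x

/-- `L^p_loc(Ω)`: `p`-integrability on every compact subset of `Ω`. -/
def MemLpLoc {N : ℕ} {F : Type*} [NormedAddCommGroup F] (Ω : Set (RN N)) (p : ℝ≥0∞)
    (f : RN N → F) : Prop :=
  ∀ K : Set (RN N), IsCompact K → K ⊆ Ω → MemLp f p (volume.restrict K)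

/-- The Sobolev space `W^{1,p}(Ω)`. -/
def MemW1p {N : ℕ} (Ω : Set (RN N)) (p : ℝ≥0∞) (u : RN N → ℝ) : Prop :=
  MemLp u p (volume.restrict Ω) ∧
    ∃ G : RN N → RN N, HasWeakGrad Ω u G ∧ MemLp G p (volume.restrict Ω)

/-- The local Sobolev space `W^{1,p}_loc(Ω)`. -/
def MemW1pLoc {N : ℕ} (Ω : Set (RN N)) (p : ℝ≥0∞) (u : RN N → ℝ) : Prop :=
  MemLpLoc Ω p u ∧ ∃ G : RN N → RN N, HasWeakGrad Ω u G ∧ MemLpLoc Ω p G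

/-- `H^1(Ω) = W^{1,2}(Ω)`. -/
def MemH1 {N : ℕ} (Ω : Set (RN N)) (u : RN N → ℝ) : Prop := MemW1p Ω 2 u

/-- `H^1_0(Ω)`: the closure of `C_c^∞(Ω)` in `H^1(Ω)`. -/
def MemH10 {N : ℕ} (Ω : Set (RN N)) (u : RN N → ℝ) : Prop :=
  MemLp u 2 (volume.restrict Ω) ∧
    ∃ G : RN N → RN N, HasWeakGrad Ω u G ∧ MemLp G 2 (volume.restrict Ω) ∧
      ∃ φ : ℕ → RN N → ℝ, (∀ n, IsTestFunction Ω (φ n)) ∧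
        Tendsto (fun n => eLpNorm (fun x => φ n x - u x) 2 (volume.restrict Ω)) atTop (𝓝 0) ∧
        Tendsto (fun n => eLpNorm (fun x => gradient (φ n) x - G x) 2 (volume.restrict Ω))
          atTop (𝓝 0)

/-- Hypothesis (L) on the coefficients of `L u = ∑ ∂_j (a^{ij} ∂_i u)`: they lie in
`L^∞(Ω) ∩ W^{1,∞}_loc(Ω)` and are uniformly elliptic. -/
structure ConditionL {N : ℕ} (Ω : Set (RN N)) (a : Fin N → Fin N → RN N → ℝ) : Prop where
  bounded : ∀ i j, MemLp (a i j) ∞ (volume.restrict Ω)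
  locLipschitz : ∀ i j, MemW1pLoc Ω ∞ (a i j)
  elliptic : ∃ η : ℝ, 0 < η ∧ ∀ᵐ x ∂(volume.restrict Ω), ∀ ξ : RN N,
    η * ‖ξ‖ ^ 2 ≤ ∑ i, ∑ j, a i j x * ξ i * ξ j

/-- `H : Ω × ℝ × ℝ^N → ℝ` is a Carathéodory function. -/
structure IsCaratheodory {N : ℕ} (Ω : Set (RN N)) (H : RN N → ℝ → RN N → ℝ) : Prop where
  meas : ∀ (s : ℝ) (ξ : RN N), AEStronglyMeasurable (fun x => H x s ξ) (volume.restrict Ω)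
  cont : ∀ᵐ x ∂(volume.restrict Ω), Continuous (fun q : ℝ × RN N => H x q.1 q.2)

/-- Hypothesis (H2) on the nonlinearity. -/
def ConditionH2 {N : ℕ} (Ω : Set (RN N)) (H : RN N → ℝ → RN N → ℝ) : Prop :=
  ∃ (b₂ : RN N → ℝ) (C₂ : ℝ → ℝ → ℝ),
    MemLpLoc Ω (N : ℝ≥0∞) b₂ ∧
    ContinuousOn (fun q : ℝ × ℝ => C₂ q.1 q.2) (Ici 0 ×ˢ Ici 0) ∧
    ∀ᵐ x ∂(volume.restrict Ω), ∀ s₁ s₂ : ℝ, s₂ ≤ s₁ → ∀ ξ₁ ξ₂ : RN N,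
      H x s₁ ξ₁ - H x s₂ ξ₂ ≤ C₂ |s₁| |s₂| * (‖ξ₁‖ + ‖ξ₂‖ + b₂ x) * ‖ξ₁ - ξ₂‖

/-- Lower solution of `-L u = H(x,u,∇u) + h`, `u = 0` on `∂Ω`. The weak gradients `G` of `u` and
`Φ` of `φ` are unique a.e. The convergence of `∫ H(x,u,∇u) φ` is part of the notion. -/
structure IsLowerSolution {N : ℕ} (Ω : Set (RN N)) (a : Fin N → Fin N → RN N → ℝ)
    (H : RN N → ℝ → RN N → ℝ) (h : RN N → ℝ) (u : RN N → ℝ) : Prop where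
  posPart : MemH10 Ω (fun x => max (u x) 0)
  ineq : ∃ G : RN N → RN N, HasWeakGrad Ω u G ∧
    ∀ (φ : RN N → ℝ) (Φ : RN N → RN N), MemH10 Ω φ → MemLp φ ∞ (volume.restrict Ω) →
      (∀ᵐ x ∂(volume.restrict Ω), 0 ≤ φ x) → HasWeakGrad Ω φ Φ →
      IntegrableOn (fun x => H x (u x) (G x) * φ x) Ω ∧
      ∑ i, ∑ j, ∫ x in Ω, a i j x * G x i * Φ x j ≤
        (∫ x in Ω, H x (u x) (G x) * φ x) + ∫ x in Ω, h x * φ x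

/-- Upper solution of `-L u = H(x,u,∇u) + h`, `u = 0` on `∂Ω`. -/
structure IsUpperSolution {N : ℕ} (Ω : Set (RN N)) (a : Fin N → Fin N → RN N → ℝ)
    (H : RN N → ℝ → RN N → ℝ) (h : RN N → ℝ) (u : RN N → ℝ) : Prop where
  negPart : MemH10 Ω (fun x => max (-u x) 0)
  ineq : ∃ G : RN N → RN N, HasWeakGrad Ω u G ∧
    ∀ (φ : RN N → ℝ) (Φ : RN N → RN N), MemH10 Ω φ → MemLp φ ∞ (volume.restrict Ω) →
      (∀ᵐ x ∂(volume.restrict Ω), 0 ≤ φ x) → HasWeakGrad Ω φ Φ →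
      IntegrableOn (fun x => H x (u x) (G x) * φ x) Ω ∧
      (∫ x in Ω, H x (u x) (G x) * φ x) + ∫ x in Ω, h x * φ x ≤
        ∑ i, ∑ j, ∫ x in Ω, a i j x * G x i * Φ x j

/-- Condition (A): every connected component of `Ω ∩ B_r(x)`, for `x ∈ ∂Ω` and small `r`, misses
a fixed proportion of the measure of `B_r(x)`. -/
def ConditionA {N : ℕ} (Ω : Set (RN N)) : Prop :=
  ∃ r₀ θ₀ : ℝ, 0 < r₀ ∧ 0 < θ₀ ∧ ∀ x ∈ frontier Ω, ∀ r : ℝ, 0 < r → r < r₀ →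
    ∀ y ∈ Ω ∩ Metric.ball x r,
      volume.real (connectedComponentIn (Ω ∩ Metric.ball x r) y) ≤
        (1 - θ₀) * volume.real (Metric.ball x r)

/-! Suppose that `w = u₁ - u₂` has a positive maximum `M` over the closure of `Ω`. Since `w ≤ 0` on
the boundary, `{w ≥ M/2}` is a compact subset `K` of `Ω`. For `M/2 < k < M` put `s = (w - k)⁺` and
test both inequalities with `s³`, which is supported in `K`. Subtracting cancels `h`; ellipticity
and (H2) leave `3η ∫ s² |∇w|² ≤ C₀ ∫ c |∇w| s³`, where `c = |∇u₁| + |∇u₂| + |b₂|` is in `L^N(K)`. In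
terms of `V = s²` and `Y = |∇V| = 2 s |∇w|` this reads `(3/4) η ∫ Y² ≤ (C₀/2) ∫ V c Y`.

Hölder with `1/q + 1/N = 1/2` and the Sobolev inequality for `V` bound the last integral by `S ‖c‖_N
‖Y‖₂²`. The norm of `c` has to be small. The set `{w > k}` need not shrink to a null set as `k → M`,
because `{w = M}` may have positive measure; but `∇w = 0` a.e. there
(`HasWeakGrad.ae_eq_zero_of_eq`), so only the strip `{k < w < M}` matters, and its measure tends to
zero (`exists_level_eLpNorm_indicator_lt`). For `k` close to `M` the energy is absorbed
(`eLpNorm_eq_zero_of_energy_le`), hence `Y = 0` and then `V = 0`, although `{w > k}` is open and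
nonempty.

Under condition (A) the boundary ordering comes from `MemH10.nonpos_of_conditionA`, applied to `u₁⁺`
and `u₂⁻`. If a function of `H¹₀(Ω)` continuous up to the boundary were positive at a boundary
point, then in a small ball `B` the indicator of any component `D` of `Ω ∩ B` would have zero weak
gradient in all of `B`, so `D` would fill `B` up to a null set.

Both halves rest on approximation by test functions: mollification puts compactly supported
functions into `H¹₀`, and the chain rule follows by passing to the limit. Powers of `s` of order at
least two are `C¹`, so a chain rule for `C¹` functions suffices. -/

open scoped Convolution

/-! ### Test functions and elementary calculus of weak gradients. -/

section WeakGradBasics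

variable {N : ℕ} {Ω : Set (RN N)}

theorem MeasureTheory.LocallyIntegrableOn.coord {G : RN N → RN N} (h : LocallyIntegrableOn G Ω) (i : Fin N) :
    LocallyIntegrableOn (fun x => G x i) Ω := fun x hx => by
  obtain ⟨s, hs, h'⟩ := h x hx
  exact ⟨s, hs, (EuclideanSpace.proj (𝕜 := ℝ) i).integrable_comp h'⟩

theorem MeasureTheory.LocallyIntegrableOn.integrable_mul_of_tsupport_subset {f ψ : RN N → ℝ}
    (hf : LocallyIntegrableOn f Ω) (hψ : Continuous ψ) (hc : HasCompactSupport ψ)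
    (hs : tsupport ψ ⊆ Ω) : Integrable (fun x => f x * ψ x) := by
  have h1 : IntegrableOn f (tsupport ψ) := hf.integrableOn_compact_subset hs hc
  have h2 : IntegrableOn (fun x => f x * ψ x) (tsupport ψ) :=
    h1.mul_continuousOn hψ.continuousOn hc
  rwa [integrableOn_iff_integrable_of_support_subset] at h2
  intro x hx
  exact subset_tsupport _ (right_ne_zero_of_mul hx)

theorem gradient_apply_eq_fderiv (f : RN N → ℝ) (x : RN N) (i : Fin N) :
    gradient f x i = fderiv ℝ f x (EuclideanSpace.single i 1) := by
  rw [← inner_gradient_left, EuclideanSpace.inner_single_right]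
  simp

namespace IsTestFunction

variable {φ ψ : RN N → ℝ}

theorem fderiv_apply (h : IsTestFunction Ω φ) (v : RN N) :
    IsTestFunction Ω (fun x => fderiv ℝ φ x v) where
  smooth := (h.smooth.fderiv_right (m := ∞) (by simp)).clm_apply contDiff_const
  compact := h.compact.fderiv_apply ℝ v
  support := (tsupport_fderiv_apply_subset ℝ v).trans h.support

theorem mul_left (h : IsTestFunction Ω φ) (hψ : ContDiff ℝ ∞ ψ) :
    IsTestFunction Ω (fun x => ψ x * φ x) where
  smooth := hψ.mul h.smooth
  compact := h.compact.mul_left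
  support := (closure_mono (fun _ hx => right_ne_zero_of_mul hx)).trans h.support

theorem integrable_mul (h : IsTestFunction Ω φ) {f : RN N → ℝ} (hf : LocallyIntegrableOn f Ω) :
    Integrable (fun x => f x * φ x) :=
  hf.integrable_mul_of_tsupport_subset h.smooth.continuous h.compact h.support

theorem setIntegral_mul (h : IsTestFunction Ω φ) (f : RN N → ℝ) :
    ∫ x in Ω, f x * φ x = ∫ x, f x * φ x :=
  setIntegral_eq_integral_of_forall_compl_eq_zero fun x hx => by
    rw [image_eq_zero_of_notMem_tsupport (fun h' => hx (h.support h')), mul_zero]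

end IsTestFunction

namespace HasWeakGrad

variable {u v : RN N → ℝ} {G V : RN N → RN N}

/-- The fundamental lemma of the calculus of variations, coordinate by coordinate. It lets the
integrability known for one weak gradient pass to any other. -/
theorem ae_eq (hΩ : IsOpen Ω) (h : HasWeakGrad Ω u G) (h' : HasWeakGrad Ω u V) :
    G =ᵐ[volume.restrict Ω] V := by
  have key : ∀ i, ∀ᵐ x, x ∈ Ω → G x i - V x i = 0 := by
    intro i
    have hG := h.locIntGrad.coord i
    have hV := h'.locIntGrad.coord i
    refine hΩ.ae_eq_zero_of_integral_contDiff_smul_eq_zero (hG.sub hV) fun φ h1 h2 h3 => ?_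
    have hφ : IsTestFunction Ω φ := ⟨h1, h2, h3⟩
    have e := h.integral_eq φ hφ i
    rw [h'.integral_eq φ hφ i, hφ.setIntegral_mul, hφ.setIntegral_mul, neg_inj] at e
    calc ∫ x, φ x • (G x i - V x i) = ∫ x, (G x i * φ x - V x i * φ x) := by
          congr 1; ext x; simp; ring
      _ = 0 := by
          rw [integral_sub (hφ.integrable_mul hG) (hφ.integrable_mul hV), e, sub_self]
  rw [EventuallyEq, ae_restrict_iff' hΩ.measurableSet]
  filter_upwards [ae_all_iff.2 key] with x hx hxΩ
  ext i
  exact sub_eq_zero.1 (hx i hxΩ)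

theorem sub (h : HasWeakGrad Ω u G) (h' : HasWeakGrad Ω v V) :
    HasWeakGrad Ω (fun x => u x - v x) (fun x => G x - V x) where
  locInt := h.locInt.sub h'.locInt
  locIntGrad := h.locIntGrad.sub h'.locIntGrad
  integral_eq φ hφ i := by
    have hd := hφ.fderiv_apply (EuclideanSpace.single i 1)
    have e1 := h.integral_eq φ hφ i
    have e2 := h'.integral_eq φ hφ i
    simp only [PiLp.sub_apply, sub_mul]
    rw [integral_sub (hd.integrable_mul h.locInt).integrableOn
      (hd.integrable_mul h'.locInt).integrableOn,
      integral_sub (hφ.integrable_mul (h.locIntGrad.coord i)).integrableOn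
      (hφ.integrable_mul (h'.locIntGrad.coord i)).integrableOn, e1, e2]
    ring

/-- If `φ` is a test function then so is `χ φ`; the identity for `u` tested with it is the product
rule. -/
theorem smooth_mul {χ : RN N → ℝ} (hΩ : IsOpen Ω) (hχ : ContDiff ℝ ∞ χ) (h : HasWeakGrad Ω u G) :
    HasWeakGrad Ω (fun x => χ x * u x) (fun x => χ x • G x + u x • gradient χ x) where
  locInt := h.locInt.continuousOn_mul hχ.continuous.continuousOn hΩ.isLocallyClosed
  locIntGrad := by
    refine (h.locIntGrad.continuousOn_smul hΩ.isLocallyClosed hχ.continuous.continuousOn).add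
      (h.locInt.smul_continuousOn hΩ.isLocallyClosed ?_)
    have : Continuous (gradient χ) :=
      (InnerProductSpace.toDual ℝ (RN N)).symm.continuous.comp (hχ.continuous_fderiv (by simp))
    exact this.continuousOn
  integral_eq φ hφ i := by
    set e : RN N := EuclideanSpace.single i 1 with he
    have hg : ∀ x, gradient χ x i = fderiv ℝ χ x e := fun x => gradient_apply_eq_fderiv χ x i
    have hm := hφ.mul_left hχ
    have hdχ : ContDiff ℝ ∞ (fun x => fderiv ℝ χ x e) :=
      (hχ.fderiv_right (m := ∞) (by simp)).clm_apply contDiff_const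
    have hd := hφ.fderiv_apply e
    have key := h.integral_eq _ hm i
    have hfd : ∀ x, fderiv ℝ (fun x => χ x * φ x) x e
        = χ x * fderiv ℝ φ x e + fderiv ℝ χ x e * φ x := by
      intro x
      rw [fderiv_fun_mul (hχ.differentiable (by simp) x) (hφ.smooth.differentiable (by simp) x)]
      simp; ring
    rw [← he] at key
    simp only [hfd, mul_add] at key
    rw [integral_add ((hd.mul_left hχ).integrable_mul h.locInt).integrableOn
      ((hφ.mul_left hdχ).integrable_mul h.locInt).integrableOn] at key
    simp only [PiLp.add_apply, PiLp.smul_apply, smul_eq_mul, hg, add_mul]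
    have i1 := (hm.integrable_mul (h.locIntGrad.coord i))
    have i2 := ((hφ.mul_left hdχ).integrable_mul h.locInt)
    have e1 : (fun x => χ x * G x i * φ x + u x * fderiv ℝ χ x e * φ x)
        = fun x => G x i * (χ x * φ x) + u x * (fderiv ℝ χ x e * φ x) := by ext x; ring
    have e2 : (fun x => χ x * u x * fderiv ℝ φ x e) = fun x => u x * (χ x * fderiv ℝ φ x e) := by
      ext x; ring
    rw [e1, e2, integral_add i1.integrableOn i2.integrableOn]
    linarith

end HasWeakGrad

end WeakGradBasics

/-! ### Translations and convergence of mollifications in `L²`. -/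

theorem tendsto_eLpNorm_translate_sub {E F : Type*} [NormedAddCommGroup E] [MeasurableSpace E]
    [BorelSpace E] [SecondCountableTopology E] [LocallyCompactSpace E]
    {μ : Measure E} [μ.IsAddHaarMeasure]
    [NormedAddCommGroup F] {p : ℝ≥0∞} (hp1 : 1 ≤ p) (hp : p ≠ ⊤) {f : E → F} (hf : MemLp f p μ) :
    Tendsto (fun t => eLpNorm (fun x => f (x - t) - f x) p μ) (𝓝 0) (𝓝 0) := by
  have : Fact (1 ≤ p) := ⟨hp1⟩
  let g : E → C(E, E) := fun t => ⟨fun x => x - t, by fun_prop⟩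
  have hg : Continuous g := ContinuousMap.continuous_of_continuous_uncurry _ (by
    show Continuous fun q : E × E => q.2 - q.1
    fun_prop)
  have hm : ∀ t, MeasurePreserving (g t) μ μ := fun t => measurePreserving_sub_right μ t
  have h := (continuous_const (y := hf.toLp f)).compMeasurePreservingLp hg hm hp
  have h0 := h.tendsto 0
  rw [tendsto_iff_edist_tendsto_0] at h0
  refine h0.congr fun t => ?_
  rw [Lp.edist_def]
  refine eLpNorm_congr_ae ?_
  have a1 : ∀ t, Lp.compMeasurePreserving (g t) (hm t) (hf.toLp f) =ᵐ[μ] fun x => f (x - t) :=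
    fun t => (Lp.coeFn_compMeasurePreserving _ _).trans
      ((hm t).quasiMeasurePreserving.ae_eq_comp hf.coeFn_toLp)
  filter_upwards [a1 t, a1 0] with x h1 h2
  rw [Pi.sub_apply, h1, h2, sub_zero]

/-- The mollification error is an average of translation errors against a probability density;
Cauchy–Schwarz pointwise and then Tonelli give the bound. -/
theorem eLpNorm_bump_convolution_sub_le {E F : Type*} [NormedAddCommGroup E] [NormedSpace ℝ E]
    [FiniteDimensional ℝ E] [MeasurableSpace E] [BorelSpace E]
    {μ : Measure E} [μ.IsAddHaarMeasure]
    [NormedAddCommGroup F] [NormedSpace ℝ F] [CompleteSpace F] {f : E → F} (hf : MemLp f 2 μ)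
    (ρ : ContDiffBump (0 : E)) {ε : ℝ≥0∞}
    (h : ∀ t ∈ Metric.ball (0 : E) ρ.rOut, eLpNorm (fun x => f (x - t) - f x) 2 μ ≤ ε) :
    eLpNorm (fun x => (ρ.normed μ ⋆[ContinuousLinearMap.lsmul ℝ ℝ, μ] f) x - f x) 2 μ ≤ ε := by
  -- Tonelli needs joint measurability of `(x, t) ↦ f (x - t) - f x`, which a.e. strong
  -- measurability does not give directly.
  wlog hsm : StronglyMeasurable f generalizing f
  · have hae := hf.1.ae_eq_mk
    have hc := convolution_congr (ContinuousLinearMap.lsmul ℝ ℝ) (ae_eq_refl (ρ.normed μ)) hae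
    have := this (f := hf.1.mk f) (hf.ae_eq hae) (fun t ht => by
      refine le_trans (le_of_eq (eLpNorm_congr_ae ?_)) (h t ht)
      have := (measurePreserving_sub_right μ t).quasiMeasurePreserving.ae_eq_comp hae
      filter_upwards [hae, this] with x h1 h2
      simp only [Function.comp_apply] at h2
      rw [h1, h2]) hf.1.stronglyMeasurable_mk
    refine le_trans (le_of_eq (eLpNorm_congr_ae ?_)) this
    filter_upwards [hae] with x h1
    rw [hc, h1]
  set r : E → ℝ≥0∞ := fun t => ENNReal.ofReal (ρ.normed μ t)
  have hr : Measurable r := (ρ.continuous_normed.measurable).ennreal_ofReal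
  have hr1 : ∫⁻ t, r t ∂μ = 1 := by
    rw [← ofReal_integral_eq_lintegral_ofReal ρ.integrable_normed
      (ae_of_all _ ρ.nonneg_normed), ρ.integral_normed, ENNReal.ofReal_one]
  have hloc : LocallyIntegrable f μ := hf.locallyIntegrable (by norm_num)
  have hconv : ∀ x, ConvolutionExistsAt (ρ.normed μ) f x (ContinuousLinearMap.lsmul ℝ ℝ) μ :=
    fun x => (ρ.hasCompactSupport_normed.convolutionExists_left _ ρ.continuous_normed hloc) x
  set D : E → E → ℝ≥0∞ := fun x t => ‖f (x - t) - f x‖ₑ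
  have hD : Measurable (Function.uncurry D) :=
    ((hsm.comp_measurable (measurable_fst.sub measurable_snd)).sub
      (hsm.comp_measurable measurable_fst)).enorm
  have hpt : ∀ x, ‖(ρ.normed μ ⋆[ContinuousLinearMap.lsmul ℝ ℝ, μ] f) x - f x‖ₑ ^ 2
      ≤ ∫⁻ t, r t * D x t ^ 2 ∂μ := by
    intro x
    have e1 : (ρ.normed μ ⋆[ContinuousLinearMap.lsmul ℝ ℝ, μ] f) x - f x
        = ∫ t, ρ.normed μ t • (f (x - t) - f x) ∂μ := by
      have : f x = ∫ t, ρ.normed μ t • f x ∂μ := (ρ.integral_normed_smul μ (f x)).symm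
      conv_lhs => rw [this]
      simp only [smul_sub]
      exact (integral_sub (hconv x) (ρ.integrable_normed.smul_const _)).symm
    have e2 : ‖(ρ.normed μ ⋆[ContinuousLinearMap.lsmul ℝ ℝ, μ] f) x - f x‖ₑ
        ≤ ∫⁻ t, r t * D x t ∂μ := by
      rw [e1]
      refine (enorm_integral_le_lintegral_enorm _).trans (le_of_eq ?_)
      congr 1; ext t
      rw [enorm_smul, Real.enorm_of_nonneg (ρ.nonneg_normed t)]
    have hDx : Measurable (D x) := hD.comp measurable_prodMk_left
    -- Cauchy–Schwarz with the weight split as `r = r^(1/2) r^(1/2)`; the other factor is the total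
    -- mass `1`.
    have e3 : ∫⁻ t, r t * D x t ∂μ ≤ (∫⁻ t, r t * D x t ^ 2 ∂μ) ^ (1/2 : ℝ) := by
      have := ENNReal.lintegral_mul_le_Lp_mul_Lq μ Real.HolderConjugate.two_two
        (f := fun t => r t ^ (1/2 : ℝ)) (g := fun t => r t ^ (1/2 : ℝ) * D x t)
        (hr.pow_const _).aemeasurable ((hr.pow_const _).mul hDx).aemeasurable
      have h2 : ∀ a : ℝ≥0∞, (a ^ (1/2 : ℝ)) ^ (2 : ℝ) = a := fun a => by
        rw [← ENNReal.rpow_mul]; norm_num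
      have h3 : ∀ a : ℝ≥0∞, a ^ (1/2 : ℝ) * a ^ (1/2 : ℝ) = a := fun a => by
        rw [← ENNReal.rpow_add_of_nonneg _ _ (by norm_num) (by norm_num)]; norm_num
      simp only [Pi.mul_apply, ← mul_assoc, h2, h3, hr1, ENNReal.mul_rpow_of_nonneg _ _ zero_le_two,
        ENNReal.one_rpow, one_mul] at this
      simpa using this
    calc _ ≤ ((∫⁻ t, r t * D x t ^ 2 ∂μ) ^ (1/2 : ℝ)) ^ 2 := by gcongr; exact e2.trans e3
      _ = _ := by rw [← ENNReal.rpow_natCast, ← ENNReal.rpow_mul]; norm_num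
  rw [eLpNorm_eq_lintegral_rpow_enorm_toReal (by norm_num) (by norm_num)]
  have h2 : ∀ t, r t * ∫⁻ x, D x t ^ 2 ∂μ ≤ r t * ε ^ 2 := by
    intro t
    by_cases ht : t ∈ Metric.ball (0 : E) ρ.rOut
    · gcongr
      have := h t ht
      rw [eLpNorm_eq_lintegral_rpow_enorm_toReal (by norm_num) (by norm_num)] at this
      have h3 := ENNReal.rpow_le_rpow this (z := 2) (by norm_num)
      rw [← ENNReal.rpow_mul] at h3
      simpa using h3
    · have : ρ.normed μ t = 0 := by
        rw [← Function.notMem_support, ρ.support_normed_eq]; exact ht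
      simp [r, this]
  have hfin : ∫⁻ x, ‖(ρ.normed μ ⋆[ContinuousLinearMap.lsmul ℝ ℝ, μ] f) x - f x‖ₑ ^ 2 ∂μ
      ≤ ε ^ 2 := by
    calc _ ≤ ∫⁻ x, ∫⁻ t, r t * D x t ^ 2 ∂μ ∂μ := lintegral_mono hpt
      _ = ∫⁻ t, ∫⁻ x, r t * D x t ^ 2 ∂μ ∂μ := by
          refine lintegral_lintegral_swap ?_
          exact ((hr.comp measurable_snd).mul (hD.pow_const 2)).aemeasurable
      _ = ∫⁻ t, r t * ∫⁻ x, D x t ^ 2 ∂μ ∂μ := by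
          congr 1; ext t
          exact lintegral_const_mul _ ((hD.comp measurable_prodMk_right).pow_const 2)
      _ ≤ ∫⁻ t, r t * ε ^ 2 ∂μ := lintegral_mono h2
      _ = ε ^ 2 := by rw [lintegral_mul_const _ hr, hr1, one_mul]
  have h5 := ENNReal.rpow_le_rpow hfin (z := 1/2) (by norm_num)
  have h6 : (ε ^ 2) ^ (1/2 : ℝ) = ε := by
    rw [← ENNReal.rpow_natCast, ← ENNReal.rpow_mul]; norm_num
  rw [h6] at h5
  simpa using h5

theorem tendsto_eLpNorm_bump_convolution_sub {E F : Type*} [NormedAddCommGroup E]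
    [NormedSpace ℝ E] [FiniteDimensional ℝ E] [MeasurableSpace E] [BorelSpace E]
    {μ : Measure E} [μ.IsAddHaarMeasure]
    [NormedAddCommGroup F] [NormedSpace ℝ F] [CompleteSpace F] {f : E → F} (hf : MemLp f 2 μ)
    {ι : Type*} {l : Filter ι} {ρ : ι → ContDiffBump (0 : E)}
    (hρ : Tendsto (fun n => (ρ n).rOut) l (𝓝 0)) :
    Tendsto (fun n => eLpNorm
      (fun x => ((ρ n).normed μ ⋆[ContinuousLinearMap.lsmul ℝ ℝ, μ] f) x - f x) 2 μ) l (𝓝 0) := by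
  have := FiniteDimensional.proper_real E
  rw [ENNReal.tendsto_nhds_zero]
  intro ε hε
  have h1 := ENNReal.tendsto_nhds_zero.1
    (tendsto_eLpNorm_translate_sub (by norm_num) (by norm_num) hf) ε hε
  obtain ⟨δ, hδ, hb⟩ := Metric.eventually_nhds_iff_ball.1 h1
  filter_upwards [hρ.eventually_lt_const hδ] with n hn
  exact eLpNorm_bump_convolution_sub_le hf (ρ n) fun t ht =>
    hb t (Metric.ball_subset_ball hn.le ht)

/-! ### Mollification of weakly differentiable functions. -/

section Mollification

variable {N : ℕ} {Ω : Set (RN N)} {v : RN N → ℝ} {G : RN N → RN N}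

theorem HasWeakGrad.congr {v' : RN N → ℝ} {G' : RN N → RN N} (h : HasWeakGrad Ω v G)
    (hΩ : IsOpen Ω)
    (hv : v' =ᵐ[volume.restrict Ω] v) (hG : G' =ᵐ[volume.restrict Ω] G) : HasWeakGrad Ω v' G' where
  locInt := by
    rw [locallyIntegrableOn_iff hΩ.isLocallyClosed]
    intro k hk hc
    exact (h.locInt.integrableOn_compact_subset hk hc).congr
      (ae_restrict_of_ae_restrict_of_subset hk hv.symm)
  locIntGrad := by
    rw [locallyIntegrableOn_iff hΩ.isLocallyClosed]
    intro k hk hc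
    exact (h.locIntGrad.integrableOn_compact_subset hk hc).congr
      (ae_restrict_of_ae_restrict_of_subset hk hG.symm)
  integral_eq φ hφ i := by
    have e1 : ∫ x in Ω, v' x * fderiv ℝ φ x (EuclideanSpace.single i 1)
        = ∫ x in Ω, v x * fderiv ℝ φ x (EuclideanSpace.single i 1) :=
      integral_congr_ae (by filter_upwards [hv] with x hx; rw [hx])
    have e2 : ∫ x in Ω, G' x i * φ x = ∫ x in Ω, G x i * φ x :=
      integral_congr_ae (by filter_upwards [hG] with x hx; rw [hx])
    rw [e1, e2, h.integral_eq φ hφ i]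

/-- The reflected kernel `t ↦ η (x - t)` is a test function in `Ω` once the ball around `x` fits
inside, and the weak identity for it is the claim. -/
theorem HasWeakGrad.gradient_bump_convolution (h : HasWeakGrad Ω v G)
    (hv : LocallyIntegrable v) (hG : LocallyIntegrable G) (ρ : ContDiffBump (0 : RN N)) {x : RN N}
    (hx : Metric.closedBall x ρ.rOut ⊆ Ω) :
    gradient (ρ.normed volume ⋆[ContinuousLinearMap.lsmul ℝ ℝ, volume] v) x =
      (ρ.normed volume ⋆[ContinuousLinearMap.lsmul ℝ ℝ, volume] G) x := by
  set η : RN N → ℝ := ρ.normed volume with hη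
  have hηs : ContDiff ℝ ∞ η := ρ.contDiff_normed
  have hηc : HasCompactSupport η := ρ.hasCompactSupport_normed
  ext i
  rw [gradient_apply_eq_fderiv]
  set e : RN N := EuclideanSpace.single i 1 with he
  have hφ : IsTestFunction Ω (fun t => η (x - t)) := by
    refine ⟨hηs.comp (contDiff_const.sub contDiff_id), ?_, ?_⟩
    · exact hηc.comp_homeomorph (Homeomorph.subLeft x)
    · refine Subset.trans (closure_minimal ?_ Metric.isClosed_closedBall) hx
      intro t ht
      have : x - t ∈ Function.support η := ht
      rw [ρ.support_normed_eq, mem_ball_zero_iff] at this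
      rw [Metric.mem_closedBall, dist_comm, dist_eq_norm]
      exact this.le
  have hfd : ∀ t, fderiv ℝ (fun t => η (x - t)) t e = - fderiv ℝ η (x - t) e := by
    intro t
    have := ((hηs.differentiable (by simp) (x - t)).hasFDerivAt).comp t
      ((hasFDerivAt_id t).const_sub x)
    rw [HasFDerivAt.fderiv (f := fun t => η (x - t)) this]
    simp
  have e1 : fderiv ℝ (η ⋆[ContinuousLinearMap.lsmul ℝ ℝ, volume] v) x e
      = ∫ t, v t * fderiv ℝ η (x - t) e := by
    rw [← convolution_flip]
    rw [(hηc.hasFDerivAt_convolution_right (ContinuousLinearMap.lsmul ℝ ℝ).flip hv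
      (hηs.of_le (by simp)) x).fderiv]
    rw [convolution_precompR_apply _ hv (hηc.fderiv ℝ) (hηs.continuous_fderiv (by simp))]
    simp [convolution_def, mul_comm]
  have key := h.integral_eq _ hφ i
  rw [hφ.setIntegral_mul, (hφ.fderiv_apply e).setIntegral_mul] at key
  simp only [hfd, mul_neg, integral_neg, neg_inj] at key
  rw [e1, key, convolution_eq_swap]
  have hint : Integrable (fun t => η (x - t) • G t) :=
    hG.integrable_smul_left_of_hasCompactSupport hφ.smooth.continuous hφ.compact
  have := (EuclideanSpace.proj (𝕜 := ℝ) i).integral_comp_comm hint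
  simp only [PiLp.proj_apply, PiLp.smul_apply, smul_eq_mul] at this
  simp only [ContinuousLinearMap.lsmul_apply]
  rw [← this]
  congr 1; ext t; ring

/-- Test functions `φ n` converging to `v` in `L²(Ω)`, with gradients converging to `G`. -/
structure IsH10Approx (Ω : Set (RN N)) (φ : ℕ → RN N → ℝ) (v : RN N → ℝ) (G : RN N → RN N) :
    Prop where
  test : ∀ n, IsTestFunction Ω (φ n)
  tendsto : Tendsto (fun n => eLpNorm (fun x => φ n x - v x) 2 (volume.restrict Ω)) atTop (𝓝 0)
  tendsto_grad :
    Tendsto (fun n => eLpNorm (fun x => gradient (φ n) x - G x) 2 (volume.restrict Ω)) atTop (𝓝 0)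

/-- The approximations are mollifications of the extension by zero, at scales below the distance
from `K` to the complement of `Ω`. -/
theorem HasWeakGrad.exists_isH10Approx {K : Set (RN N)} (hΩ : IsOpen Ω) (hK : IsCompact K)
    (hKΩ : K ⊆ Ω) (h : HasWeakGrad Ω v G) (hv : MemLp v 2 (volume.restrict Ω))
    (hG : MemLp G 2 (volume.restrict Ω)) (hv0 : ∀ x ∈ Ω, x ∉ K → v x = 0)
    (hG0 : ∀ x ∈ Ω, x ∉ K → G x = 0) : ∃ φ, IsH10Approx Ω φ v G := by
  set v' := Ω.indicator v with hv'
  set G' := Ω.indicator G with hG'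
  have hvm : MemLp v' 2 := (memLp_indicator_iff_restrict hΩ.measurableSet).2 hv
  have hGm : MemLp G' 2 := (memLp_indicator_iff_restrict hΩ.measurableSet).2 hG
  have hvl : LocallyIntegrable v' := hvm.locallyIntegrable (by norm_num)
  have hGl : LocallyIntegrable G' := hGm.locallyIntegrable (by norm_num)
  have hvs : Function.support v' ⊆ K := fun x hx => by
    by_contra hxK
    by_cases hxΩ : x ∈ Ω
    · exact hx (by simp [hv', hxΩ, hv0 x hxΩ hxK])
    · exact hx (by simp [hv', hxΩ])
  have hGs : Function.support G' ⊆ K := fun x hx => by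
    by_contra hxK
    by_cases hxΩ : x ∈ Ω
    · exact hx (by simp [hG', hxΩ, hG0 x hxΩ hxK])
    · exact hx (by simp [hG', hxΩ])
  have hw : HasWeakGrad Ω v' G' := h.congr hΩ (indicator_ae_eq_restrict hΩ.measurableSet)
    (indicator_ae_eq_restrict hΩ.measurableSet)
  obtain ⟨δ, hδ, hδΩ⟩ := hK.exists_cthickening_subset_open hΩ hKΩ
  -- Radii at most `δ / 2` use the margin `δ` twice: the mollified functions live in the `δ /
  -- 2`-thickening of `K`, and balls of that radius around its points still lie in `Ω`.
  let ρ : ℕ → ContDiffBump (0 : RN N) := fun n =>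
    ⟨δ / 2 / (n + 1) / 2, δ / 2 / (n + 1), by positivity, half_lt_self (by positivity)⟩
  have hρ0 : Tendsto (fun n => (ρ n).rOut) atTop (𝓝 0) := by
    have := tendsto_const_div_atTop_nhds_zero_nat (δ / 2)
    simpa [ρ] using (tendsto_add_atTop_iff_nat 1).2 this
  have hρδ : ∀ n, (ρ n).rOut ≤ δ / 2 := fun n => by
    refine div_le_self (by positivity) ?_
    have : (0 : ℝ) ≤ n := n.cast_nonneg
    linarith
  have hsup : ∀ n {F : Type} [NormedAddCommGroup F] [NormedSpace ℝ F] (f : RN N → F),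
      Function.support f ⊆ K → Function.support
        ((ρ n).normed volume ⋆[ContinuousLinearMap.lsmul ℝ ℝ, volume] f)
        ⊆ Metric.cthickening (δ / 2) K := by
    intro n F _ _ f hf x hx
    obtain ⟨a, ha, b, hb, rfl⟩ := support_convolution_subset _ hx
    rw [(ρ n).support_normed_eq, mem_ball_zero_iff] at ha
    refine Metric.mem_cthickening_of_dist_le _ b _ K (hf hb) ?_
    simpa using ha.le.trans (hρδ n)
  set φ : ℕ → RN N → ℝ := fun n =>
    (ρ n).normed volume ⋆[ContinuousLinearMap.lsmul ℝ ℝ, volume] v' with hφ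
  have hts : ∀ n, tsupport (φ n) ⊆ Metric.cthickening (δ / 2) K := fun n =>
    closure_minimal (hsup n v' hvs) Metric.isClosed_cthickening
  have hgrad : ∀ n x, gradient (φ n) x
      = ((ρ n).normed volume ⋆[ContinuousLinearMap.lsmul ℝ ℝ, volume] G') x := by
    intro n x
    by_cases hx : x ∈ Metric.cthickening (δ / 2) K
    · refine hw.gradient_bump_convolution hvl hGl (ρ n) (Subset.trans ?_ hδΩ)
      intro y hy
      have h1 : y ∈ Metric.cthickening (δ / 2) (Metric.cthickening (δ / 2) K) :=
        Metric.mem_cthickening_of_dist_le _ x _ _ hx ((Metric.mem_closedBall.1 hy).trans (hρδ n))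
      have := Metric.cthickening_cthickening_subset (by positivity) (by positivity) K h1
      simpa using this
    · have h1 : x ∉ Function.support
          ((ρ n).normed volume ⋆[ContinuousLinearMap.lsmul ℝ ℝ, volume] G') :=
        fun h' => hx (hsup n G' hGs h')
      rw [Function.notMem_support.1 h1, gradient,
        image_eq_zero_of_notMem_tsupport (fun h' => hx (hts n (tsupport_fderiv_subset ℝ h')))]
      simp
  refine ⟨φ, fun n => ⟨?_, ?_, ?_⟩, ?_, ?_⟩
  · exact (ρ n).hasCompactSupport_normed.contDiff_convolution_left _ (ρ n).contDiff_normed hvl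
  · exact hK.cthickening.of_isClosed_subset (isClosed_tsupport _) (hts n)
  · exact (hts n).trans ((Metric.cthickening_mono (by linarith) K).trans hδΩ)
  · refine tendsto_of_tendsto_of_tendsto_of_le_of_le tendsto_const_nhds
      (tendsto_eLpNorm_bump_convolution_sub hvm hρ0) (fun _ => zero_le) fun n => ?_
    refine le_trans (le_of_eq (eLpNorm_congr_ae ?_)) (eLpNorm_restrict_le _ _ _ Ω)
    filter_upwards [indicator_ae_eq_restrict (f := v) hΩ.measurableSet] with x hx
    rw [hv', hx]
  · refine tendsto_of_tendsto_of_tendsto_of_le_of_le tendsto_const_nhds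
      (tendsto_eLpNorm_bump_convolution_sub hGm hρ0) (fun _ => zero_le) fun n => ?_
    refine le_trans (le_of_eq (eLpNorm_congr_ae ?_)) (eLpNorm_restrict_le _ _ _ Ω)
    filter_upwards [indicator_ae_eq_restrict (f := G) hΩ.measurableSet] with x hx
    rw [hgrad, hG', hx]

end Mollification

/-! ### Hölder's inequality and limits of integrals of products. -/

theorem MeasureTheory.eLpNorm_mul_le_of_holderTriple {α : Type*} [MeasurableSpace α]
    {μ : Measure α} {f g : α → ℝ} {p q r : ℝ≥0∞} [hpqr : ENNReal.HolderTriple p q r]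
    (hf : AEStronglyMeasurable f μ) (hg : AEStronglyMeasurable g μ) :
    eLpNorm (fun x => f x * g x) r μ ≤ eLpNorm f p μ * eLpNorm g q μ := by
  have := eLpNorm_le_eLpNorm_mul_eLpNorm_of_nnnorm (p := p) (q := q) (r := r) hf hg
    (fun a b => a * b) 1 (ae_of_all _ fun x => by simp)
  simpa using this

/-- Split `F n = F₀ + (F n - F₀)`: dominated convergence handles the first part, the uniform bound
and Cauchy–Schwarz the second. In the chain rule `g n` is `f'` of an approximation and `F n` a
component of its gradient. -/
theorem MeasureTheory.tendsto_integral_bdd_mul_mul {α : Type*} [MeasurableSpace α] {μ : Measure α}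
    {g : ℕ → α → ℝ} {g₀ : α → ℝ} {F : ℕ → α → ℝ} {F₀ ψ : α → ℝ} {C : ℝ}
    (hgm : ∀ n, AEStronglyMeasurable (g n) μ) (hgb : ∀ n x, |g n x| ≤ C)
    (hg : ∀ᵐ x ∂μ, Tendsto (fun n => g n x) atTop (𝓝 (g₀ x)))
    (hFm : ∀ n, MemLp (F n) 2 μ) (hF₀ : MemLp F₀ 2 μ) (hψ : MemLp ψ 2 μ)
    (hF : Tendsto (fun n => eLpNorm (fun x => F n x - F₀ x) 2 μ) atTop (𝓝 0)) :
    Tendsto (fun n => ∫ x, g n x * F n x * ψ x ∂μ) atTop (𝓝 (∫ x, g₀ x * F₀ x * ψ x ∂μ)) := by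
  have hC : ∀ n x, ‖g n x‖ ≤ C := hgb
  have int1 : ∀ n, Integrable (fun x => g n x * (F₀ x * ψ x)) μ := fun n =>
    (hF₀.integrable_mul hψ).bdd_mul (hgm n) (ae_of_all _ (hC n))
  have intd : ∀ n, Integrable (fun x => g n x * ((F n x - F₀ x) * ψ x)) μ := fun n =>
    (((hFm n).sub hF₀).integrable_mul hψ).bdd_mul (hgm n) (ae_of_all _ (hC n))
  have t1 : Tendsto (fun n => ∫ x, g n x * (F₀ x * ψ x) ∂μ) atTop
      (𝓝 (∫ x, g₀ x * (F₀ x * ψ x) ∂μ)) := by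
    refine tendsto_integral_of_dominated_convergence (fun x => C * ‖F₀ x * ψ x‖)
      (fun n => (int1 n).1) ((hF₀.integrable_mul hψ).norm.const_mul C)
      (fun n => ae_of_all _ fun x => ?_) ?_
    · rw [norm_mul]; gcongr; exact hC n x
    · filter_upwards [hg] with x hx using hx.mul_const _
  have t2 : Tendsto (fun n => ∫ x, g n x * ((F n x - F₀ x) * ψ x) ∂μ) atTop (𝓝 0) := by
    have h0 : (0 : ℝ) = ∫ x, (0 : ℝ) ∂μ := by simp
    rw [h0]
    refine tendsto_integral_of_L1' _ aestronglyMeasurable_const (Eventually.of_forall intd) ?_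
    have hb : Tendsto (fun n => ENNReal.ofReal C *
        (eLpNorm (fun x => F n x - F₀ x) 2 μ * eLpNorm ψ 2 μ)) atTop (𝓝 0) := by
      have h1 := ENNReal.Tendsto.mul_const hF (Or.inr hψ.eLpNorm_ne_top)
      rw [zero_mul] at h1
      have h2 := ENNReal.Tendsto.const_mul h1 (Or.inr (ENNReal.ofReal_ne_top (r := C)))
      rwa [mul_zero] at h2
    refine tendsto_of_tendsto_of_tendsto_of_le_of_le tendsto_const_nhds hb
      (fun _ => zero_le) fun n => ?_
    have h1 : eLpNorm (fun x => (F n x - F₀ x) * ψ x) 1 μ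
        ≤ eLpNorm (fun x => F n x - F₀ x) 2 μ * eLpNorm ψ 2 μ := by
      have h2 : AEStronglyMeasurable (fun x => F n x - F₀ x) μ := (hFm n).1.sub hF₀.1
      exact eLpNorm_mul_le_of_holderTriple h2 hψ.1
    refine le_trans ?_ (mul_le_mul_right h1 _)
    refine eLpNorm_le_mul_eLpNorm_of_ae_le_mul (ae_of_all _ fun x => ?_) 1
    simp only [Pi.sub_apply, sub_zero]
    rw [norm_mul]; gcongr; exact hC n x
  have := t1.add t2
  rw [add_zero] at this
  have e0 : ∫ x, g₀ x * F₀ x * ψ x ∂μ = ∫ x, g₀ x * (F₀ x * ψ x) ∂μ := by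
    congr 1; ext x; ring
  rw [e0]
  refine this.congr fun n => ?_
  rw [← integral_add (int1 n) (intd n)]
  congr 1; ext x; ring

/-! ### The chain rule for weak gradients. -/

section ChainRule

variable {N : ℕ} {Ω : Set (RN N)} {v w : RN N → ℝ} {G : RN N → RN N}

theorem MeasureTheory.MemLp.coord {μ : Measure (RN N)} {p : ℝ≥0∞} (h : MemLp G p μ) (i : Fin N) :
    MemLp (fun x => G x i) p μ :=
  (EuclideanSpace.proj (𝕜 := ℝ) i).comp_memLp' h

theorem IsTestFunction.memLp {φ : RN N → ℝ} (h : IsTestFunction Ω φ) (p : ℝ≥0∞)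
    (s : Set (RN N)) : MemLp φ p (volume.restrict s) :=
  (h.smooth.continuous.memLp_of_hasCompactSupport h.compact).restrict s

theorem continuous_gradient {φ : RN N → ℝ} (h : ContDiff ℝ ∞ φ) : Continuous (gradient φ) :=
  (InnerProductSpace.toDual ℝ (RN N)).symm.continuous.comp (h.continuous_fderiv (by simp))

theorem IsTestFunction.support_gradient_subset {φ : RN N → ℝ} :
    Function.support (gradient φ) ⊆ tsupport φ := fun x hx => by
  by_contra h
  refine hx ?_
  rw [gradient, image_eq_zero_of_notMem_tsupport (fun h' => h (tsupport_fderiv_subset ℝ h'))]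
  simp

theorem IsTestFunction.hasCompactSupport_gradient {φ : RN N → ℝ} (h : IsTestFunction Ω φ) :
    HasCompactSupport (gradient φ) :=
  h.compact.mono' IsTestFunction.support_gradient_subset

theorem IsTestFunction.memLp_gradient {φ : RN N → ℝ} (h : IsTestFunction Ω φ) (p : ℝ≥0∞)
    (s : Set (RN N)) : MemLp (gradient φ) p (volume.restrict s) :=
  ((continuous_gradient h.smooth).memLp_of_hasCompactSupport
    h.hasCompactSupport_gradient).restrict s

theorem IsH10Approx.tendsto_grad_coord {φ : ℕ → RN N → ℝ} (h : IsH10Approx Ω φ v G) (i : Fin N) :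
    Tendsto (fun n => eLpNorm (fun x => gradient (φ n) x i - G x i) 2 (volume.restrict Ω))
      atTop (𝓝 0) := by
  refine tendsto_of_tendsto_of_tendsto_of_le_of_le tendsto_const_nhds h.tendsto_grad
    (fun _ => zero_le) fun _ => eLpNorm_mono fun x => ?_
  exact PiLp.norm_apply_le (gradient (φ _) x - G x) i

theorem IsH10Approx.exists_subseq_ae {φ : ℕ → RN N → ℝ} (h : IsH10Approx Ω φ v G)
    (hv : MemLp v 2 (volume.restrict Ω)) :
    ∃ ns : ℕ → ℕ, StrictMono ns ∧
      ∀ᵐ x ∂(volume.restrict Ω), Tendsto (fun n => φ (ns n) x) atTop (𝓝 (v x)) :=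
  (tendstoInMeasure_of_tendsto_eLpNorm_of_ne_top (p := 2) (by norm_num) (by norm_num)
    (fun n => ((h.test n).memLp 2 Ω).1) hv.1 h.tendsto).exists_seq_tendsto_ae

theorem IsH10Approx.subseq {φ : ℕ → RN N → ℝ} (h : IsH10Approx Ω φ v G) {ns : ℕ → ℕ}
    (hns : StrictMono ns) : IsH10Approx Ω (fun n => φ (ns n)) v G :=
  ⟨fun _ => h.test _, h.tendsto.comp hns.tendsto_atTop, h.tendsto_grad.comp hns.tendsto_atTop⟩

theorem abs_sub_le_of_hasDerivAt {f f' : ℝ → ℝ} {C : ℝ} (hf : ∀ t, HasDerivAt f (f' t) t)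
    (hb : ∀ t, |f' t| ≤ C) (s t : ℝ) : |f s - f t| ≤ C * |s - t| :=
  convex_univ.norm_image_sub_le_of_norm_hasDerivWithin_le
    (fun x _ => (hf x).hasDerivWithinAt) (fun x _ => hb x) (mem_univ t) (mem_univ s)

theorem MeasureTheory.MemLp.comp_of_deriv_le {α : Type*} [MeasurableSpace α] {μ : Measure α}
    [IsFiniteMeasure μ] {v : α → ℝ} {p : ℝ≥0∞} (hv : MemLp v p μ) {f f' : ℝ → ℝ} {C : ℝ}
    (hf : ∀ t, HasDerivAt f (f' t) t) (hb : ∀ t, |f' t| ≤ C) :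
    MemLp (fun x => f (v x)) p μ := by
  have hfc : Continuous f := continuous_iff_continuousAt.2 fun t => (hf t).continuousAt
  have h1 : MemLp (fun x => f (v x) - f 0) p μ := by
    refine MemLp.of_le_mul (c := C) hv
      ((hfc.comp_aestronglyMeasurable hv.1).sub aestronglyMeasurable_const)
      (ae_of_all _ fun x => ?_)
    simpa using abs_sub_le_of_hasDerivAt hf hb (v x) 0
  have h2 := h1.add (memLp_const (f 0))
  refine h2.ae_eq (ae_of_all _ fun x => ?_)
  simp

theorem IsTestFunction.integral_comp_mul_fderiv {φ ψ : RN N → ℝ} (hφ : ContDiff ℝ ∞ φ)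
    (hψ : IsTestFunction Ω ψ) {f f' : ℝ → ℝ} (hf : ∀ t, HasDerivAt f (f' t) t)
    (hc : Continuous f') (i : Fin N) :
    ∫ x in Ω, f (φ x) * fderiv ℝ ψ x (EuclideanSpace.single i 1)
      = - ∫ x in Ω, f' (φ x) * gradient φ x i * ψ x := by
  set e : RN N := EuclideanSpace.single i 1 with he
  have hfc : Continuous f := continuous_iff_continuousAt.2 fun t => (hf t).continuousAt
  have hcomp : ∀ x, HasFDerivAt (fun x => f (φ x)) (f' (φ x) • fderiv ℝ φ x) x := fun x =>
    (hf (φ x)).comp_hasFDerivAt x (hφ.differentiable (by simp) x).hasFDerivAt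
  have hgr : Continuous fun x => fderiv ℝ φ x e :=
    (hφ.continuous_fderiv (by simp)).clm_apply continuous_const
  have hd := hψ.fderiv_apply e
  rw [hd.setIntegral_mul, hψ.setIntegral_mul]
  have := integral_mul_fderiv_eq_neg_fderiv_mul_of_integrable (μ := (volume : Measure (RN N)))
    (f := fun x => f (φ x)) (g := ψ) (v := e) ?_ ?_ ?_ ?_ ?_
  · rw [this]
    congr 2; ext x
    rw [(hcomp x).fderiv, gradient_apply_eq_fderiv]
    rfl
  · simp only [fun x => (hcomp x).fderiv]
    refine Continuous.integrable_of_hasCompactSupport ?_ hψ.compact.mul_left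
    exact ((hc.comp hφ.continuous).mul hgr).mul hψ.smooth.continuous
  · exact ((hfc.comp hφ.continuous).mul hd.smooth.continuous).integrable_of_hasCompactSupport
      hd.compact.mul_left
  · exact ((hfc.comp hφ.continuous).mul hψ.smooth.continuous).integrable_of_hasCompactSupport
      hψ.compact.mul_left
  · exact fun x _ => (hcomp x).differentiableAt
  · exact fun x _ => hψ.smooth.differentiable (by simp) x

theorem IsH10Approx.tendsto_comp {φ : ℕ → RN N → ℝ} (h : IsH10Approx Ω φ v G)
    {f f' : ℝ → ℝ} {C : ℝ} (hf : ∀ t, HasDerivAt f (f' t) t) (hb : ∀ t, |f' t| ≤ C) :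
    Tendsto (fun n => eLpNorm (fun x => f (φ n x) - f (v x)) 2 (volume.restrict Ω))
      atTop (𝓝 0) := by
  have h1 := ENNReal.Tendsto.const_mul h.tendsto (Or.inr (ENNReal.ofReal_ne_top (r := C)))
  rw [mul_zero] at h1
  exact tendsto_of_tendsto_of_tendsto_of_le_of_le tendsto_const_nhds h1 (fun _ => zero_le)
    fun n => eLpNorm_le_mul_eLpNorm_of_ae_le_mul
      (ae_of_all _ fun x => abs_sub_le_of_hasDerivAt hf hb _ _) 2

/-- Along an a.e. convergent subsequence `f' (φ n)` converges boundedly while the gradients converge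
in `L²`, so the classical identity passes to the limit. -/
theorem IsH10Approx.integral_comp_mul_fderiv [IsFiniteMeasure (volume.restrict Ω)]
    {φ : ℕ → RN N → ℝ} (h : IsH10Approx Ω φ v G)
    (hv : MemLp v 2 (volume.restrict Ω)) (hG : MemLp G 2 (volume.restrict Ω))
    {f f' : ℝ → ℝ} {C : ℝ} (hf : ∀ t, HasDerivAt f (f' t) t)
    (hc : Continuous f') (hb : ∀ t, |f' t| ≤ C) {ψ : RN N → ℝ} (hψ : IsTestFunction Ω ψ)
    (i : Fin N) :
    ∫ x in Ω, f (v x) * fderiv ℝ ψ x (EuclideanSpace.single i 1)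
      = - ∫ x in Ω, f' (v x) * G x i * ψ x := by
  obtain ⟨ns, hns, hae⟩ := h.exists_subseq_ae hv
  replace h := h.subseq hns
  have hd := hψ.fderiv_apply (EuclideanSpace.single i 1)
  have t1 := tendsto_integral_bdd_mul_mul (μ := volume.restrict Ω)
    (g := fun n x => f' (φ (ns n) x)) (g₀ := fun x => f' (v x))
    (F := fun n x => gradient (φ (ns n)) x i) (F₀ := fun x => G x i) (ψ := ψ) (C := C)
    (fun n => (hc.comp (h.test n).smooth.continuous).aestronglyMeasurable)
    (fun n x => hb _) (by filter_upwards [hae] with x hx using (hc.tendsto _).comp hx)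
    (fun n => ((h.test n).memLp_gradient 2 Ω).coord i) (hG.coord i) (hψ.memLp 2 Ω)
    (h.tendsto_grad_coord i)
  have t2 := tendsto_integral_bdd_mul_mul (μ := volume.restrict Ω)
    (g := fun n x => 1) (g₀ := fun x => 1)
    (F := fun n x => f (φ (ns n) x)) (F₀ := fun x => f (v x))
    (ψ := fun x => fderiv ℝ ψ x (EuclideanSpace.single i 1)) (C := 1)
    (fun n => aestronglyMeasurable_const)
    (fun n x => by simp) (ae_of_all _ fun x => tendsto_const_nhds)
    (fun n => ((h.test n).memLp 2 Ω).comp_of_deriv_le hf hb) (hv.comp_of_deriv_le hf hb)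
    (hd.memLp 2 Ω) (h.tendsto_comp hf hb)
  simp only [one_mul] at t2
  refine tendsto_nhds_unique t2 (t1.neg.congr fun n => ?_)
  exact (IsTestFunction.integral_comp_mul_fderiv (h.test n).smooth hψ hf hc i).symm

theorem exists_isTestFunction_eq_one {K : Set (RN N)} (hK : IsCompact K) (hΩ : IsOpen Ω)
    (hKΩ : K ⊆ Ω) : ∃ χ : RN N → ℝ, IsTestFunction Ω χ ∧ ∀ x ∈ K, χ x = 1 := by
  obtain ⟨δ, hδ, hδΩ⟩ := hK.exists_cthickening_subset_open hΩ hKΩ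
  obtain ⟨χ, h1, -, h3, h4⟩ := exists_contMDiff_support_eq_eq_one_iff (n := ⊤)
    (modelWithCornersSelf ℝ (RN N)) (Metric.isOpen_thickening (δ := δ) (E := K)) hK.isClosed
    (Metric.self_subset_thickening hδ K)
  have hs : tsupport χ ⊆ Metric.cthickening δ K := by
    rw [tsupport, h3]; exact Metric.closure_thickening_subset_cthickening δ K
  exact ⟨χ, ⟨h1.contDiff, hK.cthickening.of_isClosed_subset (isClosed_tsupport _) hs,
    hs.trans hδΩ⟩, fun x hx => (h4 x).1 hx⟩

theorem MeasureTheory.MemLp.bdd_smul {α F : Type*} [MeasurableSpace α] [NormedAddCommGroup F]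
    [NormedSpace ℝ F] {μ : Measure α} {g : α → ℝ} {f : α → F} {C : ℝ} {p : ℝ≥0∞} (hf : MemLp f p μ)
    (hg : AEStronglyMeasurable g μ) (hb : ∀ᵐ x ∂μ, |g x| ≤ C) : MemLp (fun x => g x • f x) p μ :=
  hf.of_le_mul (c := C) (hg.smul hf.1) (by
    filter_upwards [hb] with x hx
    rw [norm_smul]
    gcongr
    exact hx)

/-- Chain rule for a `C¹` function with bounded derivative. -/
theorem HasWeakGrad.comp [IsFiniteMeasure (volume.restrict Ω)] (hΩ : IsOpen Ω)
    (h : HasWeakGrad Ω w G)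
    (hw : MemLp w 2 (volume.restrict Ω)) (hG : MemLp G 2 (volume.restrict Ω))
    {f f' : ℝ → ℝ} {C : ℝ} (hf : ∀ t, HasDerivAt f (f' t) t)
    (hc : Continuous f') (hb : ∀ t, |f' t| ≤ C) :
    HasWeakGrad Ω (fun x => f (w x)) (fun x => f' (w x) • G x) where
  locInt := IntegrableOn.locallyIntegrableOn
    ((hw.comp_of_deriv_le hf hb).integrable (by norm_num))
  locIntGrad := IntegrableOn.locallyIntegrableOn
    ((hG.bdd_smul (hc.comp_aestronglyMeasurable hw.1) (ae_of_all _ fun x => hb _)).integrable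
      (by norm_num))
  integral_eq ψ hψ i := by
    -- The function `w` need not be in `H¹₀(Ω)`, but `χ w` has compact support and agrees with `w`
    -- wherever `ψ` is felt.
    obtain ⟨χ, hχ, hχ1⟩ := exists_isTestFunction_eq_one hψ.compact hΩ hψ.support
    obtain ⟨C1, hC1⟩ := hχ.compact.exists_bound_of_continuous hχ.smooth.continuous
    obtain ⟨C2, hC2⟩ := hχ.hasCompactSupport_gradient.exists_bound_of_continuous
      (continuous_gradient hχ.smooth)
    have hcut := h.smooth_mul hΩ hχ.smooth
    have m1 : MemLp (fun x => χ x * w x) 2 (volume.restrict Ω) :=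
      hw.bdd_smul hχ.smooth.continuous.aestronglyMeasurable (ae_of_all _ hC1)
    have m2 : MemLp (fun x => χ x • G x + w x • gradient χ x) 2 (volume.restrict Ω) := by
      refine (hG.bdd_smul hχ.smooth.continuous.aestronglyMeasurable (ae_of_all _ hC1)).add ?_
      refine hw.of_le_mul (c := C2)
        (hw.1.smul (continuous_gradient hχ.smooth).aestronglyMeasurable) (ae_of_all _ fun x => ?_)
      rw [norm_smul, mul_comm]
      gcongr
      exact hC2 x
    obtain ⟨φ, hφ⟩ := hcut.exists_isH10Approx hΩ hχ.compact hχ.support m1 m2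
      (fun x _ hx => by simp [image_eq_zero_of_notMem_tsupport hx])
      (fun x _ hx => by
        have h2 : gradient χ x = 0 :=
          Function.notMem_support.1 fun h' => hx (IsTestFunction.support_gradient_subset h')
        simp [image_eq_zero_of_notMem_tsupport hx, h2])
    have key := hφ.integral_comp_mul_fderiv m1 m2 hf hc hb hψ i
    have e1 : ∀ x, f (χ x * w x) * fderiv ℝ ψ x (EuclideanSpace.single i 1)
        = f (w x) * fderiv ℝ ψ x (EuclideanSpace.single i 1) := by
      intro x
      by_cases hx : x ∈ tsupport ψ
      · rw [hχ1 x hx, one_mul]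
      · have : fderiv ℝ ψ x = 0 :=
          image_eq_zero_of_notMem_tsupport (fun h' => hx (tsupport_fderiv_subset ℝ h'))
        simp [this]
    have e2 : ∀ x, f' (χ x * w x) * (χ x • G x + w x • gradient χ x) i * ψ x
        = (f' (w x) • G x) i * ψ x := by
      intro x
      -- The open support, unlike `tsupport ψ`, gives `χ = 1` on a whole neighbourhood, so the
      -- gradient of `χ` vanishes.
      by_cases hx : x ∈ Function.support ψ
      · have h1 : χ =ᶠ[𝓝 x] fun _ => 1 := by
          filter_upwards [hψ.smooth.continuous.isOpen_support.mem_nhds hx] with y hy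
          exact hχ1 y (subset_tsupport _ hy)
        have h2 : gradient χ x = 0 := by
          rw [gradient, h1.fderiv_eq]; simp
        simp [h2, h1.self_of_nhds]
      · simp [Function.notMem_support.1 hx]
    simpa only [e1, e2] using key

/-- Chain rule for a `C¹` function of a bounded function. -/
theorem HasWeakGrad.comp_of_bounded [IsFiniteMeasure (volume.restrict Ω)] (hΩ : IsOpen Ω)
    (h : HasWeakGrad Ω w G)
    (hw : MemLp w 2 (volume.restrict Ω)) (hG : MemLp G 2 (volume.restrict Ω)) {R : ℝ}
    (hR : ∀ x ∈ Ω, |w x| ≤ R)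
    {f f' : ℝ → ℝ} (hf : ∀ t, HasDerivAt f (f' t) t) (hc : Continuous f') :
    HasWeakGrad Ω (fun x => f (w x)) (fun x => f' (w x) • G x) := by
  obtain rfl | ⟨x₀, hx₀⟩ := Ω.eq_empty_or_nonempty
  · refine ⟨by simp [LocallyIntegrableOn], by simp [LocallyIntegrableOn], by simp⟩
  have hR0 : 0 ≤ R := (abs_nonneg _).trans (hR x₀ hx₀)
  set c : ℝ → ℝ := fun t => max (-R) (min R t) with hcdef
  have hcc : Continuous c := by fun_prop
  have hcm : ∀ t, c t ∈ Icc (-R) R := fun t =>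
    ⟨le_max_left _ _, max_le (by linarith) (min_le_left _ _)⟩
  have hcid : ∀ t, |t| ≤ R → c t = t := fun t ht => by
    rw [abs_le] at ht
    simp [hcdef, ht.1, ht.2]
  have hg : Continuous fun t => f' (c t) := hc.comp hcc
  obtain ⟨C, hC⟩ := isCompact_Icc.exists_bound_of_continuousOn (hc.continuousOn (s := Icc (-R) R))
  -- Clamping the argument of `f'` gives a bounded derivative without changing `f` on `[-R, R]`,
  -- which contains the base point `0` since `R ≥ 0`.
  set F : ℝ → ℝ := fun t => f 0 + ∫ s in (0 : ℝ)..t, f' (c s) with hF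
  have hFd : ∀ t, HasDerivAt F (f' (c t)) t := fun t =>
    (intervalIntegral.integral_hasDerivAt_right (hg.intervalIntegrable _ _)
      hg.stronglyMeasurable.stronglyMeasurableAtFilter hg.continuousAt).const_add _
  have hFf : ∀ t, |t| ≤ R → F t = f t := by
    intro t ht
    have h1 : ∫ s in (0 : ℝ)..t, f' (c s) = ∫ s in (0 : ℝ)..t, f' s := by
      refine intervalIntegral.integral_congr fun s hs => ?_
      have : |s| ≤ R := by
        have := abs_sub_left_of_mem_uIcc hs
        simp only [sub_zero] at this
        exact this.trans ht
      simp only [hcid s this]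
    rw [hF]
    simp only
    rw [h1, intervalIntegral.integral_eq_sub_of_hasDerivAt (fun s _ => hf s)
      (hc.intervalIntegrable _ _)]
    ring
  have := h.comp hΩ hw hG hFd hg (fun t => hC _ (hcm t))
  refine this.congr hΩ ?_ ?_
  · filter_upwards [ae_restrict_mem hΩ.measurableSet] with x hx
    rw [hFf _ (hR x hx)]
  · filter_upwards [ae_restrict_mem hΩ.measurableSet] with x hx
    simp only [hcid _ (hR x hx)]

end ChainRule

/-! ### Gradients on level sets, and the Sobolev inequality. -/

section LevelSets

variable {N : ℕ} {Ω : Set (RN N)} {v w : RN N → ℝ} {G : RN N → RN N}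

/-- The weak gradient vanishes almost everywhere on level sets. -/
theorem HasWeakGrad.ae_eq_zero_of_eq [IsFiniteMeasure (volume.restrict Ω)] (hΩ : IsOpen Ω)
    (h : HasWeakGrad Ω w G)
    (hw : MemLp w 2 (volume.restrict Ω)) (hG : MemLp G 2 (volume.restrict Ω)) (M : ℝ) :
    ∀ᵐ x ∂(volume.restrict Ω), w x = M → G x = 0 := by
  classical
  -- The functions `f n` tend to zero uniformly while `f n' = g n` tends boundedly to the indicator
  -- of `{M}`. In the limit the zero function has weak gradient `1_{w = M} G`, and uniqueness
  -- concludes.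
  set g : ℕ → ℝ → ℝ := fun n t => 1 / (1 + (((n : ℝ) + 1) * (t - M)) ^ 2) with hg
  set f : ℕ → ℝ → ℝ := fun n t => Real.arctan (((n : ℝ) + 1) * (t - M)) / (n + 1) with hf
  have hn : ∀ n : ℕ, (0 : ℝ) < n + 1 := fun n => by positivity
  have hd : ∀ n t, HasDerivAt (f n) (g n t) t := by
    intro n t
    have h1 : HasDerivAt (fun t => ((n : ℝ) + 1) * (t - M)) ((n : ℝ) + 1) t := by
      simpa using ((hasDerivAt_id t).sub_const M).const_mul ((n : ℝ) + 1)
    have h2 := (h1.arctan).div_const ((n : ℝ) + 1)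
    refine h2.congr_deriv ?_
    rw [mul_div_assoc, div_self (hn n).ne', mul_one]
  have hpos : ∀ n t, 0 < 1 + (((n : ℝ) + 1) * (t - M)) ^ 2 := fun n t => by positivity
  have hgc : ∀ n, Continuous (g n) := fun n =>
    continuous_const.div (by fun_prop) fun t => (hpos n t).ne'
  have hgb : ∀ n t, |g n t| ≤ 1 := fun n t => by
    rw [abs_of_pos (one_div_pos.2 (hpos n t))]
    exact (div_le_one (hpos n t)).2 (by nlinarith [sq_nonneg (((n : ℝ) + 1) * (t - M))])
  have hglim : ∀ t, Tendsto (fun n => g n t) atTop (𝓝 (if t = M then 1 else 0)) := by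
    intro t
    split_ifs with ht
    · simp [hg, ht]
    · have h0 : 0 < (t - M) ^ 2 := by
        have := sub_ne_zero.2 ht
        positivity
      refine squeeze_zero (fun n => (one_div_pos.2 (hpos n t)).le)
        (g := fun n : ℕ => (1 / (t - M) ^ 2) / ((n : ℝ) + 1)) (fun n => ?_) ?_
      · rw [div_div]
        refine one_div_le_one_div_of_le (by positivity) ?_
        have h1 : (1 : ℝ) ≤ n + 1 := by
          have : (0 : ℝ) ≤ n := n.cast_nonneg
          linarith
        have h2 : ((n : ℝ) + 1) ≤ (n + 1) ^ 2 := by nlinarith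
        rw [mul_pow]
        nlinarith
      · have := tendsto_const_div_atTop_nhds_zero_nat (1 / (t - M) ^ 2)
        simpa using (tendsto_add_atTop_iff_nat 1).2 this
  have hfb : ∀ n t, |f n t| ≤ 2 / ((n : ℝ) + 1) := by
    intro n t
    simp only [hf]
    rw [abs_div, abs_of_pos (hn n)]
    gcongr
    rw [abs_le]
    have h1 := Real.arctan_lt_pi_div_two (((n : ℝ) + 1) * (t - M))
    have h2 := Real.neg_pi_div_two_lt_arctan (((n : ℝ) + 1) * (t - M))
    have h3 := Real.pi_le_four
    constructor <;> linarith
  set G₀ : RN N → RN N := fun x => (if w x = M then (1 : ℝ) else 0) • G x with hG₀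
  have hmeas : AEStronglyMeasurable (fun x => if w x = M then (1 : ℝ) else 0)
      (volume.restrict Ω) := by
    have : Measurable fun t : ℝ => if t = M then (1 : ℝ) else 0 :=
      Measurable.ite (measurableSet_singleton M) measurable_const measurable_const
    exact (this.comp_aemeasurable hw.1.aemeasurable).aestronglyMeasurable
  have h0 : HasWeakGrad Ω (fun _ => 0) G₀ := by
    refine ⟨locallyIntegrableOn_const 0, IntegrableOn.locallyIntegrableOn
      ((hG.bdd_smul (C := 1) hmeas (ae_of_all _ fun x => ?_)).integrable (by norm_num)),
      fun ψ hψ i => ?_⟩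
    · split_ifs <;> simp
    have hdψ := hψ.fderiv_apply (EuclideanSpace.single i 1)
    have e := fun n => (h.comp hΩ hw hG (hd n) (hgc n) (hgb n)).integral_eq ψ hψ i
    have hint : Integrable (fun x => G x i * ψ x) (volume.restrict Ω) :=
      (hG.coord i).integrable_mul (hψ.memLp 2 Ω)
    have t1 : Tendsto (fun n => ∫ x in Ω, (g n (w x) • G x) i * ψ x) atTop
        (𝓝 (∫ x in Ω, G₀ x i * ψ x)) := by
      refine tendsto_integral_of_dominated_convergence (fun x => ‖G x i * ψ x‖)
        (fun n => ?_) hint.norm (fun n => ae_of_all _ fun x => ?_) (ae_of_all _ fun x => ?_)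
      · have := ((hgc n).comp_aestronglyMeasurable hw.1).mul hint.1
        refine this.congr (ae_of_all _ fun x => ?_)
        simp [mul_assoc]
      · simp only [PiLp.smul_apply, smul_eq_mul, mul_assoc]
        rw [norm_mul]
        exact mul_le_of_le_one_left (norm_nonneg _) (hgb n _)
      · simp only [PiLp.smul_apply, smul_eq_mul, hG₀]
        exact ((hglim (w x)).mul_const _).mul_const _
    have t2 : Tendsto (fun n => ∫ x in Ω, f n (w x) * fderiv ℝ ψ x (EuclideanSpace.single i 1))
        atTop (𝓝 0) := by
      have hi : Integrable (fun x => ‖fderiv ℝ ψ x (EuclideanSpace.single i 1)‖)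
          (volume.restrict Ω) := ((hdψ.memLp 2 Ω).integrable (by norm_num)).norm
      refine squeeze_zero_norm (a := fun n : ℕ => (2 / ((n : ℝ) + 1)) *
        ∫ x in Ω, ‖fderiv ℝ ψ x (EuclideanSpace.single i 1)‖) (fun n => ?_) ?_
      · rw [← integral_const_mul]
        refine norm_integral_le_of_norm_le (hi.const_mul _) (ae_of_all _ fun x => ?_)
        rw [norm_mul]
        gcongr
        exact hfb n _
      · have := tendsto_const_div_atTop_nhds_zero_nat (2 : ℝ)
        have h2 := (tendsto_add_atTop_iff_nat 1).2 this
        push_cast at h2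
        simpa using h2.mul_const _
    have := tendsto_nhds_unique t2 (t1.neg.congr fun n => (e n).symm)
    simpa using this
  have h00 : HasWeakGrad Ω (fun _ => 0) (fun _ => (0 : RN N)) :=
    ⟨locallyIntegrableOn_const 0, locallyIntegrableOn_const 0, fun ψ hψ i => by simp⟩
  filter_upwards [h0.ae_eq hΩ h00] with x hx hxM
  simpa [hG₀, hxM] using hx

theorem norm_gradient (f : RN N → ℝ) (x : RN N) : ‖gradient f x‖ = ‖fderiv ℝ f x‖ := by
  simp [gradient]

/-- Sobolev inequality in `H¹₀(Ω)`. -/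
theorem IsH10Approx.eLpNorm_le {φ : ℕ → RN N → ℝ} (hΩ : IsOpen Ω)
    (h : IsH10Approx Ω φ v G) (hv : MemLp v 2 (volume.restrict Ω))
    (hG : MemLp G 2 (volume.restrict Ω)) (hN : 0 < N) {q : NNReal}
    (hq : (q : ℝ)⁻¹ = 2⁻¹ - (N : ℝ)⁻¹) :
    eLpNorm v q (volume.restrict Ω) ≤
      ENNReal.ofNNReal (SNormLESNormFDerivOfEqConst ℝ (volume : Measure (RN N)) 2) *
        eLpNorm G 2 (volume.restrict Ω) := by
  set S : ℝ≥0∞ := ENNReal.ofNNReal (SNormLESNormFDerivOfEqConst ℝ (volume : Measure (RN N)) 2)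
  have hS : S ≠ ⊤ := ENNReal.coe_ne_top
  obtain ⟨ns, hns, hae⟩ := h.exists_subseq_ae hv
  replace h := h.subseq hns
  -- Fatou: the `L^q` norm is lower semicontinuous under a.e. convergence, so Sobolev for test
  -- functions suffices.
  refine (Lp.eLpNorm_lim_le_liminf_eLpNorm (fun n => ((h.test n).memLp 2 Ω).1) v hae).trans ?_
  have hb : ∀ n, eLpNorm (φ (ns n)) q (volume.restrict Ω) ≤
      S * (eLpNorm (fun x => gradient (φ (ns n)) x - G x) 2 (volume.restrict Ω) +
        eLpNorm G 2 (volume.restrict Ω)) := by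
    intro n
    have h1 := eLpNorm_le_eLpNorm_fderiv_of_eq (μ := (volume : Measure (RN N)))
      (u := φ (ns n)) ((h.test n).smooth.of_le (by simp)) (h.test n).compact (p := 2) (p' := q)
      (by norm_num) (by simpa using hN) (by simpa using hq)
    have h2 : eLpNorm (fderiv ℝ (φ (ns n))) 2 volume
        = eLpNorm (gradient (φ (ns n))) 2 (volume.restrict Ω) := by
      rw [eLpNorm_congr_norm_ae (g := gradient (φ (ns n)))
        (ae_of_all _ fun x => (norm_gradient _ x).symm)]
      rw [← eLpNorm_indicator_eq_eLpNorm_restrict hΩ.measurableSet, indicator_eq_self.2]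
      exact IsTestFunction.support_gradient_subset.trans (h.test n).support
    refine (eLpNorm_restrict_le _ _ _ Ω).trans (h1.trans ?_)
    rw [ENNReal.coe_ofNat, h2]
    refine mul_le_mul_right ?_ S
    have h3 := eLpNorm_add_le (((h.test n).memLp_gradient 2 Ω).sub hG).1 hG.1
      (p := 2) (by norm_num)
    rw [sub_add_cancel] at h3
    exact h3
  have ht : Tendsto (fun n => S * (eLpNorm (fun x => gradient (φ (ns n)) x - G x) 2
      (volume.restrict Ω) + eLpNorm G 2 (volume.restrict Ω))) atTop
      (𝓝 (S * (0 + eLpNorm G 2 (volume.restrict Ω)))) :=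
    ENNReal.Tendsto.const_mul (h.tendsto_grad.add tendsto_const_nhds) (Or.inr hS)
  rw [zero_add] at ht
  rw [← ht.liminf_eq]
  exact liminf_le_liminf (Eventually.of_forall hb)

end LevelSets

/-! ### Boundary values of `H¹₀` functions under condition (A). -/

section BoundaryValues

variable {N : ℕ} {Ω : Set (RN N)}

/-- A function with zero weak gradient in a ball is almost everywhere constant there. -/
theorem HasWeakGrad.exists_ae_eq_const {v : RN N → ℝ} {x₀ : RN N} {r : ℝ} (hr : 0 < r)
    (h : HasWeakGrad (Metric.ball x₀ r) v (fun _ => 0)) (hv : LocallyIntegrable v) :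
    ∃ c : ℝ, ∀ᵐ x ∂(volume.restrict (Metric.ball x₀ r)), v x = c := by
  let ρ : ℕ → ContDiffBump (0 : RN N) := fun n =>
    ⟨1 / ((n : ℝ) + 1) / 2, 1 / ((n : ℝ) + 1), by positivity, half_lt_self (by positivity)⟩
  have hρ0 : Tendsto (fun n => (ρ n).rOut) atTop (𝓝 0) := tendsto_one_div_add_atTop_nhds_zero_nat
  have hae := ContDiffBump.ae_convolution_tendsto_right_of_locallyIntegrable
    (μ := (volume : Measure (RN N))) (φ := ρ) (K := 2) hρ0
    (Eventually.of_forall fun n => by simp [ρ]; field_simp; norm_num) hv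
  -- Mollifications have zero gradient on slightly smaller concentric balls, which are convex, and
  -- converge a.e. to `v`.
  have hconst : ∀ n, ∀ x ∈ Metric.ball x₀ (r - (ρ n).rOut), ∀ y ∈ Metric.ball x₀ (r - (ρ n).rOut),
      ((ρ n).normed volume ⋆[ContinuousLinearMap.lsmul ℝ ℝ, volume] v) x =
      ((ρ n).normed volume ⋆[ContinuousLinearMap.lsmul ℝ ℝ, volume] v) y := by
    intro n x hx y hy
    have hs : ContDiff ℝ (⊤ : ℕ∞)
        ((ρ n).normed volume ⋆[ContinuousLinearMap.lsmul ℝ ℝ, volume] v) :=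
      (ρ n).hasCompactSupport_normed.contDiff_convolution_left _ (ρ n).contDiff_normed hv
    refine Metric.isOpen_ball.is_const_of_fderiv_eq_zero (𝕜 := ℝ)
      (convex_ball x₀ (r - (ρ n).rOut)).isPreconnected
      (hs.differentiable (by simp)).differentiableOn (fun z hz => ?_) hx hy
    have := h.gradient_bump_convolution hv (locallyIntegrable_const 0) (ρ n) (x := z) (by
      intro t ht
      rw [Metric.mem_ball] at hz ⊢
      rw [Metric.mem_closedBall] at ht
      linarith [dist_triangle t z x₀])
    have h0 : (fun _ : RN N => (0 : RN N)) = 0 := rfl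
    rw [h0, convolution_zero] at this
    rw [Pi.zero_apply, ← norm_eq_zero, ← norm_gradient, this]
    simp
  have hev : ∀ x ∈ Metric.ball x₀ r, ∀ᶠ n in atTop, x ∈ Metric.ball x₀ (r - (ρ n).rOut) := by
    intro x hx
    rw [Metric.mem_ball] at hx
    filter_upwards [hρ0.eventually_lt_const (sub_pos.2 hx)] with n hn
    rw [Metric.mem_ball]
    linarith
  have hae' := ae_restrict_of_ae (s := Metric.ball x₀ r) hae
  have hmem := ae_restrict_mem (μ := (volume : Measure (RN N)))
    (Metric.isOpen_ball (x := x₀) (ε := r)).measurableSet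
  have hne : (ae (volume.restrict (Metric.ball x₀ r))).NeBot := by
    rw [ae_neBot, Ne, Measure.restrict_eq_zero]
    exact (Metric.measure_ball_pos volume x₀ hr).ne'
  obtain ⟨y, hy, hyB⟩ := (hae'.and hmem).exists
  refine ⟨v y, ?_⟩
  filter_upwards [hae', hmem] with x hx hxB
  refine tendsto_nhds_unique hx (hy.congr' ?_)
  filter_upwards [hev x hxB, hev y hyB] with n h1 h2
  exact (hconst n x h1 y h2).symm

/-- Cutting off to one component creates no jump inside `B`. A point of `B` outside the component
either lies in `U`, and then its own open component is disjoint from the given one, or lies off `U`,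
and then `g` vanishes nearby. -/
theorem hasFDerivAt_indicator_connectedComponentIn {U B : Set (RN N)} (hU : IsOpen U)
    (hB : IsOpen B) (y : RN N) {g : RN N → ℝ} {g' : RN N → RN N →L[ℝ] ℝ}
    (hg : ∀ x, HasFDerivAt g (g' x) x) (hgU : tsupport g ⊆ U) {x : RN N} (hx : x ∈ B) :
    HasFDerivAt ((connectedComponentIn (U ∩ B) y).indicator g)
      ((connectedComponentIn (U ∩ B) y).indicator g' x) x := by
  set D := connectedComponentIn (U ∩ B) y
  have hUB : IsOpen (U ∩ B) := hU.inter hB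
  have hD : IsOpen D := hUB.connectedComponentIn
  by_cases hxD : x ∈ D
  · rw [indicator_of_mem hxD]
    refine (hg x).congr_of_eventuallyEq ?_
    filter_upwards [hD.mem_nhds hxD] with z hz
    rw [indicator_of_mem hz]
  · rw [indicator_of_notMem hxD]
    have hz : D.indicator g =ᶠ[𝓝 x] fun _ => 0 := by
      by_cases hxU : x ∈ U
      · have hmem : x ∈ connectedComponentIn (U ∩ B) x := mem_connectedComponentIn ⟨hxU, hx⟩
        filter_upwards [(hUB.connectedComponentIn (x := x)).mem_nhds hmem] with z hz
        refine indicator_of_notMem (fun hzD => hxD ?_) _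
        have e1 := connectedComponentIn_eq hz
        have e2 := connectedComponentIn_eq hzD
        show x ∈ connectedComponentIn (U ∩ B) y
        rw [e2, ← e1]
        exact hmem
      · filter_upwards [(isClosed_tsupport g).isOpen_compl.mem_nhds fun h' => hxU (hgU h')]
          with z hz
        by_cases hzD : z ∈ D
        · rw [indicator_of_mem hzD, image_eq_zero_of_notMem_tsupport hz]
        · rw [indicator_of_notMem hzD]
    exact (hasFDerivAt_const 0 x).congr_of_eventuallyEq hz

/-- Integration by parts for the cut-off of `f ∘ φ` to the component, which is differentiable
throughout `B`; `f 0 = 0` keeps the support of `f ∘ φ` in `U`. Note that `ψ` need not vanish on the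
part of the boundary of `U` inside `B`. -/
theorem integral_connectedComponentIn_mul_fderiv {U B : Set (RN N)} (hU : IsOpen U)
    (hB : IsOpen B) (y : RN N) {φ ψ : RN N → ℝ} (hφ : IsTestFunction U φ) (hψ : IsTestFunction B ψ)
    {f f' : ℝ → ℝ} (hf : ∀ t, HasDerivAt f (f' t) t) (hc : Continuous f') (hf0 : f 0 = 0)
    (i : Fin N) :
    ∫ x in connectedComponentIn (U ∩ B) y, f (φ x) * fderiv ℝ ψ x (EuclideanSpace.single i 1)
      = - ∫ x in connectedComponentIn (U ∩ B) y, f' (φ x) * gradient φ x i * ψ x := by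
  set D := connectedComponentIn (U ∩ B) y with hDdef
  have hD : MeasurableSet D := (hU.inter hB).connectedComponentIn.measurableSet
  set e : RN N := EuclideanSpace.single i 1 with he
  have hfc : Continuous f := continuous_iff_continuousAt.2 fun t => (hf t).continuousAt
  have hcomp : ∀ x, HasFDerivAt (fun x => f (φ x)) (f' (φ x) • fderiv ℝ φ x) x := fun x =>
    (hf (φ x)).comp_hasFDerivAt x (hφ.smooth.differentiable (by simp) x).hasFDerivAt
  have hgU : tsupport (fun x => f (φ x)) ⊆ U := by
    refine (closure_mono fun x hx => ?_).trans hφ.support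
    intro h0
    exact hx (by simp [h0, hf0])
  have hder : ∀ x ∈ B, HasFDerivAt (D.indicator fun x => f (φ x))
      (D.indicator (fun x => f' (φ x) • fderiv ℝ φ x) x) x := fun x hx =>
    hasFDerivAt_indicator_connectedComponentIn hU hB y hcomp hgU hx
  have hgr : Continuous fun x => fderiv ℝ φ x e :=
    (hφ.smooth.continuous_fderiv (by simp)).clm_apply continuous_const
  have hd := hψ.fderiv_apply e
  have c1 : Integrable fun x => f' (φ x) * gradient φ x i * ψ x := by
    simp only [gradient_apply_eq_fderiv]
    exact (((hc.comp hφ.smooth.continuous).mul hgr).mul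
      hψ.smooth.continuous).integrable_of_hasCompactSupport hψ.compact.mul_left
  have c2 : Integrable fun x => f (φ x) * fderiv ℝ ψ x e :=
    ((hfc.comp hφ.smooth.continuous).mul hd.smooth.continuous).integrable_of_hasCompactSupport
      hd.compact.mul_left
  have c3 : Integrable fun x => f (φ x) * ψ x :=
    ((hfc.comp hφ.smooth.continuous).mul hψ.smooth.continuous).integrable_of_hasCompactSupport
      hψ.compact.mul_left
  have e1 : (fun x => fderiv ℝ (D.indicator fun x => f (φ x)) x e * ψ x)
      = D.indicator fun x => f' (φ x) * gradient φ x i * ψ x := by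
    ext x
    by_cases hx : x ∈ tsupport ψ
    · rw [(hder x (hψ.support hx)).fderiv]
      by_cases hxD : x ∈ D
      · simp only [indicator_of_mem hxD, gradient_apply_eq_fderiv]
        rfl
      · simp [indicator_of_notMem hxD]
    · rw [image_eq_zero_of_notMem_tsupport hx, mul_zero]
      by_cases hxD : x ∈ D
      · simp [indicator_of_mem hxD, image_eq_zero_of_notMem_tsupport hx]
      · simp [indicator_of_notMem hxD]
  have e2 : ∀ q : RN N → ℝ, (fun x => (D.indicator fun x => f (φ x)) x * q x)
      = D.indicator fun x => f (φ x) * q x := fun q => by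
    ext x
    exact (indicator_mul_left D (fun x => f (φ x)) q).symm
  rw [← integral_indicator hD, ← integral_indicator hD, ← e1, ← e2]
  refine integral_mul_fderiv_eq_neg_fderiv_mul_of_integrable ?_ ?_ ?_ ?_ ?_
  · rw [e1]; exact c1.indicator hD
  · rw [e2]; exact c2.indicator hD
  · rw [e2]; exact c3.indicator hD
  · exact fun x hx => (hder x (hψ.support hx)).differentiableAt
  · exact fun x _ => hψ.smooth.differentiable (by simp) x

theorem exists_bound_deriv_smoothTransition : ∃ C, ∀ t, |deriv Real.smoothTransition t| ≤ C := by
  have hc : Continuous (deriv Real.smoothTransition) :=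
    (Real.smoothTransition.contDiff (n := 1)).continuous_deriv le_rfl
  obtain ⟨C, hC⟩ := isCompact_Icc.exists_bound_of_continuousOn (hc.continuousOn (s := Icc 0 1))
  refine ⟨max C 0, fun t => ?_⟩
  by_cases ht : t ∈ Icc (0 : ℝ) 1
  · exact (hC t ht).trans (le_max_left _ _)
  · have : deriv Real.smoothTransition t = 0 := by
      rw [mem_Icc, not_and_or, not_le, not_le] at ht
      rcases ht with ht | ht
      · have : Real.smoothTransition =ᶠ[𝓝 t] fun _ => 0 := by
          filter_upwards [gt_mem_nhds ht] with s hs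
          exact Real.smoothTransition.zero_of_nonpos hs.le
        rw [this.deriv_eq]; simp
      · have : Real.smoothTransition =ᶠ[𝓝 t] fun _ => 1 := by
          filter_upwards [lt_mem_nhds ht] with s hs
          exact Real.smoothTransition.one_of_one_le hs.le
        rw [this.deriv_eq]; simp
    rw [this]; simp

/-- Under condition (A), a function of `H¹₀(Ω)` continuous up to the boundary is nonpositive
there. -/
theorem MemH10.nonpos_of_conditionA (hΩ : IsOpen Ω) (hA : ConditionA Ω) {u : RN N → ℝ}
    (hu : MemH10 Ω u) (hc : ContinuousOn u (closure Ω)) : ∀ x ∈ frontier Ω, u x ≤ 0 := by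
  intro x₀ hx₀
  by_contra! hpos
  obtain ⟨r₀, θ₀, hr₀, hθ₀, hA⟩ := hA
  obtain ⟨huL, G, -, hG, φ, hφ, ht, htg⟩ := hu
  have hx₀c : x₀ ∈ closure Ω := frontier_subset_closure hx₀
  set ε := u x₀ / 2 with hε
  have hε0 : 0 < ε := by positivity
  have hnear : ∀ᶠ y in 𝓝[closure Ω] x₀, ε < u y :=
    (hc x₀ hx₀c).eventually_const_lt (by linarith)
  obtain ⟨r₁, hr₁, hr₁'⟩ := Metric.mem_nhdsWithin_iff.1 hnear
  set r := min r₁ (r₀ / 2) with hr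
  have hr0 : 0 < r := lt_min hr₁ (by positivity)
  have hrr : r < r₀ := (min_le_right _ _).trans_lt (by linarith)
  set B := Metric.ball x₀ r with hBdef
  have hB : IsOpen B := Metric.isOpen_ball
  have huB : ∀ y ∈ Ω ∩ B, ε < u y := fun y hy =>
    hr₁' ⟨Metric.ball_subset_ball (min_le_left _ _) hy.2, subset_closure hy.1⟩
  obtain ⟨y, hyB, hyΩ⟩ := mem_closure_iff.1 hx₀c B hB (Metric.mem_ball_self hr0)
  set D := connectedComponentIn (Ω ∩ B) y with hD
  have hDsub : D ⊆ Ω ∩ B := connectedComponentIn_subset _ _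
  have hDo : IsOpen D := (hΩ.inter hB).connectedComponentIn
  have hyD : y ∈ D := mem_connectedComponentIn ⟨hyΩ, hyB⟩
  have hBfin : volume B ≠ ⊤ := measure_ball_lt_top.ne
  have hDfin : volume D ≠ ⊤ := measure_ne_top_of_subset (hDsub.trans inter_subset_right) hBfin
  have : IsFiniteMeasure (volume.restrict D) := isFiniteMeasure_restrict.2 hDfin
  have hle : volume.restrict D ≤ volume.restrict Ω :=
    Measure.restrict_mono (hDsub.trans inter_subset_left) le_rfl
  obtain ⟨C, hC⟩ := exists_bound_deriv_smoothTransition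
  -- This `f` vanishes at `0` and equals `1` above `ε`, so `f (u) = 1` and `f' (u) = 0` on `D`.
  set f : ℝ → ℝ := fun t => Real.smoothTransition (t / ε) with hf
  set f' : ℝ → ℝ := fun t => deriv Real.smoothTransition (t / ε) / ε with hf'
  have hsm : ContDiff ℝ 1 Real.smoothTransition := Real.smoothTransition.contDiff
  have hfd : ∀ t, HasDerivAt f (f' t) t := by
    intro t
    have h1 := (hsm.differentiable (by simp) (t / ε)).hasDerivAt.comp t
      ((hasDerivAt_id t).div_const ε)
    refine h1.congr_deriv ?_
    simp [hf', div_eq_mul_inv]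
  have hf'c : Continuous f' :=
    ((hsm.continuous_deriv le_rfl).comp (continuous_id.div_const ε)).div_const ε
  have hf'b : ∀ t, |f' t| ≤ C / ε := fun t => by
    simp only [hf']
    rw [abs_div, abs_of_pos hε0]
    gcongr
    exact hC _
  have hf1 : ∀ t, ε < t → f t = 1 := fun t ht =>
    Real.smoothTransition.one_of_one_le ((one_le_div hε0).2 ht.le)
  have hf'0 : ∀ t, ε < t → f' t = 0 := fun t ht => by
    have : f =ᶠ[𝓝 t] fun _ => 1 := by
      filter_upwards [lt_mem_nhds ht] with s hs using hf1 s hs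
    rw [← (hfd t).deriv, this.deriv_eq]; simp
  have happ : IsH10Approx Ω φ u G := ⟨hφ, ht, htg⟩
  obtain ⟨ns, hns, hae⟩ := happ.exists_subseq_ae huL
  replace happ := happ.subseq hns
  have hmemD := ae_restrict_mem (μ := (volume : Measure (RN N))) hDo.measurableSet
  -- Integrate by parts over `D` for the approximations of `u`, then let `n → ∞`: the gradient term
  -- disappears because `f' (u) = 0` on `D`.
  have hzero : ∀ ψ, IsTestFunction B ψ → ∀ i : Fin N,
      ∫ x in D, fderiv ℝ ψ x (EuclideanSpace.single i 1) = 0 := by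
    intro ψ hψ i
    have t1 := tendsto_integral_bdd_mul_mul (μ := volume.restrict D)
      (g := fun n x => f' (φ (ns n) x)) (g₀ := fun x => 0)
      (F := fun n x => gradient (φ (ns n)) x i) (F₀ := fun x => G x i) (ψ := ψ) (C := C / ε)
      (fun n => (hf'c.comp (happ.test n).smooth.continuous).aestronglyMeasurable)
      (fun n x => hf'b _) (by
        filter_upwards [ae_mono hle hae, hmemD] with x hx hxD
        have := (hf'c.tendsto _).comp hx
        rwa [hf'0 _ (huB x (hDsub hxD))] at this)
      (fun n => ((happ.test n).memLp_gradient 2 D).coord i) ((hG.mono_measure hle).coord i)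
      (hψ.memLp 2 D)
      (tendsto_of_tendsto_of_tendsto_of_le_of_le tendsto_const_nhds (happ.tendsto_grad_coord i)
        (fun _ => zero_le) fun n => eLpNorm_mono_measure _ hle)
    have t2 := tendsto_integral_bdd_mul_mul (μ := volume.restrict D)
      (g := fun n x => 1) (g₀ := fun x => 1)
      (F := fun n x => f (φ (ns n) x)) (F₀ := fun x => f (u x))
      (ψ := fun x => fderiv ℝ ψ x (EuclideanSpace.single i 1)) (C := 1)
      (fun n => aestronglyMeasurable_const)
      (fun n x => by simp) (ae_of_all _ fun x => tendsto_const_nhds)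
      (fun n => ((happ.test n).memLp 2 D).comp_of_deriv_le hfd hf'b)
      ((huL.mono_measure hle).comp_of_deriv_le hfd hf'b)
      ((hψ.fderiv_apply _).memLp 2 D)
      (tendsto_of_tendsto_of_tendsto_of_le_of_le tendsto_const_nhds (happ.tendsto_comp hfd hf'b)
        (fun _ => zero_le) fun n => eLpNorm_mono_measure _ hle)
    simp only [one_mul] at t2
    simp only [zero_mul, integral_zero] at t1
    have h0 := tendsto_nhds_unique t2 (t1.neg.congr fun n =>
      (integral_connectedComponentIn_mul_fderiv hΩ hB y (happ.test n) hψ hfd hf'c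
        (by simp [hf]) i).symm)
    rw [neg_zero] at h0
    rw [← h0]
    refine integral_congr_ae ?_
    filter_upwards [hmemD] with x hxD
    rw [hf1 _ (huB x (hDsub hxD)), one_mul]
  have hloc : LocallyIntegrable (D.indicator fun _ => (1 : ℝ)) :=
    (integrable_indicator_iff hDo.measurableSet).2
      (integrableOn_const hDfin) |>.locallyIntegrable
  have hwg : HasWeakGrad B (D.indicator fun _ => (1 : ℝ)) (fun _ => 0) := by
    refine ⟨hloc.locallyIntegrableOn B, locallyIntegrableOn_const 0, fun ψ hψ i => ?_⟩
    rw [(hψ.fderiv_apply _).setIntegral_mul]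
    have : (fun x => D.indicator (fun _ => (1 : ℝ)) x * fderiv ℝ ψ x (EuclideanSpace.single i 1))
        = D.indicator fun x => fderiv ℝ ψ x (EuclideanSpace.single i 1) := by
      ext x
      by_cases hx : x ∈ D <;> simp [hx]
    rw [this, integral_indicator hDo.measurableSet, hzero ψ hψ i]
    simp
  obtain ⟨c, hcst⟩ := hwg.exists_ae_eq_const hr0 hloc
  have hDB : D ⊆ B := hDsub.trans inter_subset_right
  have hne : (ae (volume.restrict D)).NeBot := by
    rw [ae_neBot, Ne, Measure.restrict_eq_zero]
    exact (hDo.measure_pos volume ⟨y, hyD⟩).ne'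
  have hc1 : c = 1 := by
    obtain ⟨z, hz, hzD⟩ := ((ae_restrict_of_ae_restrict_of_subset hDB hcst).and hmemD).exists
    rw [← hz, indicator_of_mem hzD]
  -- The indicator of `D` is a.e. equal to `1` in `B`, so `D` has full measure there, against the
  -- factor `1 - θ₀ < 1`.
  have hBD : volume B ≤ volume D := by
    refine measure_mono_ae ?_
    filter_upwards [(ae_restrict_iff' hB.measurableSet).1 hcst] with z hz hzB
    by_contra hzD
    have := hz hzB
    rw [indicator_of_notMem (show z ∉ D from hzD), hc1] at this
    exact zero_ne_one this
  have h1 := hA x₀ hx₀ r hr0 hrr y ⟨hyΩ, hyB⟩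
  have h2 : volume.real B ≤ volume.real D := ENNReal.toReal_mono hDfin hBD
  have h3 : 0 < volume.real B :=
    ENNReal.toReal_pos (Metric.measure_ball_pos volume x₀ hr0).ne' hBfin
  change volume.real D ≤ (1 - θ₀) * volume.real B at h1
  nlinarith

end BoundaryValues

/-! ### Ingredients of the truncation argument. -/

/-- Exponents from `2` on remove the corner at `k`: there the derivative is obtained as the limit of
the derivatives at nearby points. -/
theorem hasDerivAt_max_sub_pow (k : ℝ) (n : ℕ) (t : ℝ) :
    HasDerivAt (fun t : ℝ => max (t - k) 0 ^ (n + 2)) ((n + 2) * max (t - k) 0 ^ (n + 1)) t := by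
  have hne : ∀ y : ℝ, y ≠ k → HasDerivAt (fun t : ℝ => max (t - k) 0 ^ (n + 2))
      ((n + 2) * max (y - k) 0 ^ (n + 1)) y := by
    intro y hy
    rcases lt_or_gt_of_ne hy with hy | hy
    · have h1 : (fun t : ℝ => max (t - k) 0 ^ (n + 2)) =ᶠ[𝓝 y] fun _ => 0 := by
        filter_upwards [gt_mem_nhds hy] with s hs
        rw [max_eq_right (by linarith)]; simp
      rw [max_eq_right (by linarith)]
      simpa using (hasDerivAt_const y (0 : ℝ)).congr_of_eventuallyEq h1
    · have h1 : (fun t : ℝ => max (t - k) 0 ^ (n + 2)) =ᶠ[𝓝 y] fun t => (t - k) ^ (n + 2) := by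
        filter_upwards [lt_mem_nhds hy] with s hs
        rw [max_eq_left (by linarith)]
      rw [max_eq_left (by linarith)]
      have h2 := (((hasDerivAt_id y).sub_const k).pow (n + 2)).congr_of_eventuallyEq h1
      refine h2.congr_deriv ?_
      simp
  by_cases ht : t = k
  · subst ht
    exact hasDerivAt_of_hasDerivAt_of_ne hne (by fun_prop) (by fun_prop)
  · exact hne t ht

section Comparison

variable {N : ℕ} {Ω : Set (RN N)} {w : RN N → ℝ} {G G₁ G₂ : RN N → RN N}

/-- The powers `((w - k)⁺) ^ (n + 2)` of a bounded `H¹` function belong to `H¹₀(Ω)` as soon as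
`{k < w}` is relatively compact in `Ω`. -/
theorem HasWeakGrad.max_sub_pow [IsFiniteMeasure (volume.restrict Ω)] (hΩ : IsOpen Ω)
    (h : HasWeakGrad Ω w G) (hw : MemLp w 2 (volume.restrict Ω))
    (hG : MemLp G 2 (volume.restrict Ω)) {R : ℝ} (hR : ∀ x ∈ Ω, |w x| ≤ R) {k : ℝ}
    {K : Set (RN N)} (hK : IsCompact K) (hKΩ : K ⊆ Ω) (hk : ∀ x ∈ Ω, k < w x → x ∈ K) (n : ℕ) :
    HasWeakGrad Ω (fun x => max (w x - k) 0 ^ (n + 2))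
        (fun x => ((n + 2) * max (w x - k) 0 ^ (n + 1)) • G x) ∧
      MemLp (fun x => max (w x - k) 0 ^ (n + 2)) ⊤ (volume.restrict Ω) ∧
      MemLp (fun x => ((n + 2) * max (w x - k) 0 ^ (n + 1)) • G x) 2 (volume.restrict Ω) ∧
      ∃ φ, IsH10Approx Ω φ (fun x => max (w x - k) 0 ^ (n + 2))
        (fun x => ((n + 2) * max (w x - k) 0 ^ (n + 1)) • G x) := by
  have hb : ∀ x ∈ Ω, max (w x - k) 0 ≤ R + |k| := fun x hx => by
    have h1 := hR x hx
    have h2 := le_abs_self (w x)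
    have h3 := neg_abs_le k
    exact max_le (by linarith) (by linarith [abs_nonneg (w x), abs_nonneg k])
  have hwg := h.comp_of_bounded hΩ hw hG hR (f := fun t => max (t - k) 0 ^ (n + 2))
    (f' := fun t => (n + 2) * max (t - k) 0 ^ (n + 1)) (hasDerivAt_max_sub_pow k n) (by fun_prop)
  have hmax : Continuous fun t : ℝ => max (t - k) 0 := by fun_prop
  have m1 : MemLp (fun x => max (w x - k) 0 ^ (n + 2)) ⊤ (volume.restrict Ω) := by
    refine memLp_top_of_bound ((hmax.pow (n + 2)).comp_aestronglyMeasurable hw.1)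
      ((R + |k|) ^ (n + 2)) ?_
    filter_upwards [ae_restrict_mem hΩ.measurableSet] with x hx
    rw [Real.norm_of_nonneg (by positivity)]
    gcongr
    exact hb x hx
  have m2 : MemLp (fun x => ((n + 2) * max (w x - k) 0 ^ (n + 1)) • G x) 2
      (volume.restrict Ω) := by
    refine hG.bdd_smul (C := (n + 2) * (R + |k|) ^ (n + 1))
      ((continuous_const.mul (hmax.pow (n + 1))).comp_aestronglyMeasurable hw.1) ?_
    filter_upwards [ae_restrict_mem hΩ.measurableSet] with x hx
    rw [abs_of_nonneg (by positivity)]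
    gcongr
    exact hb x hx
  have hz : ∀ x ∈ Ω, x ∉ K → max (w x - k) 0 = 0 := fun x hx hxK =>
    max_eq_right (by linarith [not_lt.1 (fun h' => hxK (hk x hx h'))])
  refine ⟨hwg, m1, m2, hwg.exists_isH10Approx hΩ hK hKΩ (m1.mono_exponent le_top) m2 ?_ ?_⟩
  · intro x hx hxK
    simp [hz x hx hxK]
  · intro x hx hxK
    simp [hz x hx hxK]

theorem integrable_coeff_mul_mul {μ : Measure (RN N)} {α f g : RN N → ℝ} (hα : MemLp α ⊤ μ)
    (hf : MemLp f 2 μ) (hg : MemLp g 2 μ) : Integrable (fun x => α x * f x * g x) μ :=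
  (MemLp.mul (p := ⊤) (q := 2) (r := 2) hf hα).integrable_mul hg

/-- Coercivity of the bilinear form on the difference of two gradients. -/
theorem elliptic_le {a : Fin N → Fin N → RN N → ℝ} {η : ℝ} {t : RN N → ℝ}
    (ha : ∀ i j, MemLp (a i j) ⊤ (volume.restrict Ω))
    (hη : ∀ᵐ x ∂(volume.restrict Ω), ∀ ξ : RN N, η * ‖ξ‖ ^ 2 ≤ ∑ i, ∑ j, a i j x * ξ i * ξ j)
    (h₁ : MemLp G₁ 2 (volume.restrict Ω)) (h₂ : MemLp G₂ 2 (volume.restrict Ω))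
    (ht : ∀ x, 0 ≤ t x)
    (hΦ : MemLp (fun x => t x • (G₁ x - G₂ x)) 2 (volume.restrict Ω)) :
    ∫ x in Ω, η * (t x * ‖G₁ x - G₂ x‖ ^ 2) ≤
      (∑ i, ∑ j, ∫ x in Ω, a i j x * G₁ x i * (t x • (G₁ x - G₂ x)) j) -
        ∑ i, ∑ j, ∫ x in Ω, a i j x * G₂ x i * (t x • (G₁ x - G₂ x)) j := by
  have int1 : ∀ i j, Integrable (fun x => a i j x * G₁ x i * (t x • (G₁ x - G₂ x)) j)
      (volume.restrict Ω) := fun i j =>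
    integrable_coeff_mul_mul (ha i j) (h₁.coord i) (hΦ.coord j)
  have int2 : ∀ i j, Integrable (fun x => a i j x * G₂ x i * (t x • (G₁ x - G₂ x)) j)
      (volume.restrict Ω) := fun i j =>
    integrable_coeff_mul_mul (ha i j) (h₂.coord i) (hΦ.coord j)
  have int3 : ∀ i j, Integrable (fun x => a i j x * G₁ x i * (t x • (G₁ x - G₂ x)) j
      - a i j x * G₂ x i * (t x • (G₁ x - G₂ x)) j) (volume.restrict Ω) := fun i j =>
    (int1 i j).sub (int2 i j)
  have e : (∑ i, ∑ j, ∫ x in Ω, a i j x * G₁ x i * (t x • (G₁ x - G₂ x)) j) -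
        ∑ i, ∑ j, ∫ x in Ω, a i j x * G₂ x i * (t x • (G₁ x - G₂ x)) j
      = ∫ x in Ω, ∑ i, ∑ j, (a i j x * G₁ x i * (t x • (G₁ x - G₂ x)) j
          - a i j x * G₂ x i * (t x • (G₁ x - G₂ x)) j) := by
    rw [integral_finsetSum _ fun i _ => integrable_finsetSum _ fun j _ => int3 i j,
      ← Finset.sum_sub_distrib]
    refine Finset.sum_congr rfl fun i _ => ?_
    rw [integral_finsetSum _ fun j _ => int3 i j, ← Finset.sum_sub_distrib]
    exact Finset.sum_congr rfl fun j _ => (integral_sub (int1 i j) (int2 i j)).symm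
  rw [e]
  refine integral_mono_ae ?_ (integrable_finsetSum _ fun i _ => integrable_finsetSum _ fun j _ =>
    int3 i j) ?_
  · have := ((h₁.sub h₂).norm.integrable_mul hΦ.norm).const_mul η
    refine this.congr (ae_of_all _ fun x => ?_)
    simp only [Pi.mul_apply, Pi.sub_apply]
    rw [norm_smul, Real.norm_of_nonneg (ht x)]
    ring
  · filter_upwards [hη] with x hx
    have h1 := mul_le_mul_of_nonneg_left (hx (G₁ x - G₂ x)) (ht x)
    refine le_trans (le_of_eq (by ring)) (h1.trans (le_of_eq ?_))
    rw [Finset.mul_sum]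
    refine Finset.sum_congr rfl fun i _ => ?_
    rw [Finset.mul_sum]
    refine Finset.sum_congr rfl fun j _ => ?_
    simp only [PiLp.sub_apply, PiLp.smul_apply, smul_eq_mul]
    ring

/-- `L^p` mass on the strips `{k < w < M}` is small when `k` is close to `M`. -/
theorem exists_level_eLpNorm_indicator_lt (hΩ : IsOpen Ω) (hfin : volume Ω ≠ ⊤)
    (hw : ContinuousOn w Ω)
    {M k₀ : ℝ} (hk₀ : k₀ < M) {K : Set (RN N)}
    (hsub : ∀ x ∈ Ω, k₀ < w x → x ∈ K) {p : ℝ≥0∞} (hp1 : 1 ≤ p) (hp : p ≠ ⊤) {c : RN N → ℝ}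
    (hc : MemLp c p (volume.restrict K)) {ε : ℝ≥0∞} (hε : 0 < ε) :
    ∃ k, k₀ < k ∧ k < M ∧
      eLpNorm ((Ω ∩ w ⁻¹' Ioo k M).indicator c) p (volume.restrict Ω) < ε := by
  obtain ⟨ε', hε', hεε'⟩ := ENNReal.lt_iff_exists_nnreal_btwn.1 hε
  obtain ⟨δ, hδ, hind⟩ := hc.eLpNorm_indicator_le hp1 hp (ε := (ε' : ℝ))
    (by exact_mod_cast hε')
  -- The shift by `2` keeps every level, including the one for `n = 0`, strictly above `k₀`.
  set k : ℕ → ℝ := fun n => M - (M - k₀) / ((n : ℝ) + 2) with hk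
  have hMk : 0 < M - k₀ := by linarith
  have hkM : ∀ n, k n < M := fun n => by
    have : 0 < (M - k₀) / ((n : ℝ) + 2) := by positivity
    simp only [hk]; linarith
  have hkk : ∀ n, k₀ < k n := fun n => by
    have : (M - k₀) / ((n : ℝ) + 2) < M - k₀ := by
      refine div_lt_self hMk ?_
      have : (0 : ℝ) ≤ n := n.cast_nonneg
      linarith
    simp only [hk]; linarith
  have hklim : Tendsto k atTop (𝓝 M) := by
    have h1 := tendsto_const_div_atTop_nhds_zero_nat (M - k₀)
    have h2 := (tendsto_add_atTop_iff_nat 2).2 h1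
    push_cast at h2
    simpa [hk] using h2.const_sub M
  have hmono : Monotone k := fun m n hmn => by
    have : (m : ℝ) ≤ n := by exact_mod_cast hmn
    simp only [hk]
    gcongr
  set E : ℕ → Set (RN N) := fun n => Ω ∩ w ⁻¹' Ioo (k n) M with hE
  have hEo : ∀ n, IsOpen (E n) := fun n => hw.isOpen_inter_preimage hΩ isOpen_Ioo
  have hlim : Tendsto (fun n => volume (E n)) atTop (𝓝 0) := by
    -- It is essential that the strips exclude `{w = M}`; otherwise that level set would be the
    -- intersection.
    have hinter : ⋂ n, E n = ∅ := by
      rw [eq_empty_iff_forall_notMem]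
      intro x hx
      rw [mem_iInter] at hx
      have h1 : M ≤ w x := le_of_tendsto' hklim fun n => (hx n).2.1.le
      exact absurd (hx 0).2.2 (not_lt.2 h1)
    have := tendsto_measure_iInter_atTop (μ := (volume : Measure (RN N))) (s := E)
      (fun n => (hEo n).measurableSet.nullMeasurableSet)
      (fun m n hmn x hx => ⟨hx.1, (hmono hmn).trans_lt hx.2.1, hx.2.2⟩)
      ⟨0, measure_ne_top_of_subset inter_subset_left hfin⟩
    rwa [hinter, measure_empty] at this
  obtain ⟨n, hn⟩ := (hlim.eventually_lt_const (ENNReal.ofReal_pos.2 hδ)).exists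
  refine ⟨k n, hkk n, hkM n, ?_⟩
  have hEK : E n ⊆ K := fun x hx => hsub x hx.1 ((hkk n).trans hx.2.1)
  have h1 := hind (E n) (hEo n).measurableSet ((Measure.restrict_apply_le _ _).trans hn.le)
  rw [eLpNorm_indicator_eq_eLpNorm_restrict (hEo n).measurableSet,
    Measure.restrict_restrict (hEo n).measurableSet, inter_eq_left.2 hEK] at h1
  rw [eLpNorm_indicator_eq_eLpNorm_restrict (hEo n).measurableSet,
    Measure.restrict_restrict (hEo n).measurableSet, inter_eq_left.2 (inter_subset_left)]
  refine h1.trans_lt ?_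
  rwa [ENNReal.ofReal_coe_nnreal]

/-- Energy estimate closing the truncation argument: if `V` is controlled by its gradient in `L^q`
and the weight `c` is small in `L^N`, then the gradient vanishes. -/
theorem eLpNorm_eq_zero_of_energy_le {α : Type*} [MeasurableSpace α] {μ : Measure α}
    {V c Y : α → ℝ} {q n S : ℝ≥0∞} [ENNReal.HolderTriple q n 2] {A B : ℝ} (hB : 0 < B)
    (hVm : AEStronglyMeasurable V μ) (hcm : AEStronglyMeasurable c μ) (hY : MemLp Y 2 μ)
    (hsob : eLpNorm V q μ ≤ S * eLpNorm Y 2 μ)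
    (hsmall : ENNReal.ofReal A * (S * eLpNorm c n μ) < ENNReal.ofReal B)
    (hen : B * ∫ x, Y x ^ 2 ∂μ ≤ A * ∫ x, V x * c x * Y x ∂μ) (hA : 0 ≤ A) :
    eLpNorm Y 2 μ = 0 := by
  set X := eLpNorm Y 2 μ with hX
  have hXt : X ≠ ⊤ := hY.eLpNorm_ne_top
  -- Hölder twice: `L² · L²` into `L¹`, then `L^q · L^n` into `L²`.
  have h1 : eLpNorm (fun x => V x * c x * Y x) 1 μ ≤ S * eLpNorm c n μ * X * X := by
    refine (eLpNorm_mul_le_of_holderTriple (p := 2) (q := 2) (hVm.mul hcm) hY.1).trans ?_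
    gcongr
    refine (eLpNorm_mul_le_of_holderTriple (p := q) (q := n) hVm hcm).trans ?_
    calc _ ≤ S * X * eLpNorm c n μ := by gcongr
      _ = _ := by ring
  have h2 : ENNReal.ofReal (∫ x, V x * c x * Y x ∂μ) ≤ S * eLpNorm c n μ * X * X := by
    refine le_trans ?_ h1
    rw [eLpNorm_one_eq_lintegral_enorm]
    refine le_trans ?_ (enorm_integral_le_lintegral_enorm _)
    exact Real.ofReal_le_enorm _
  have h3 : ENNReal.ofReal (∫ x, Y x ^ 2 ∂μ) = X * X := by
    have e1 := hY.eLpNorm_eq_integral_rpow_norm (by norm_num) (by norm_num)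
    have hI : 0 ≤ ∫ x, Y x ^ 2 ∂μ := integral_nonneg fun x => sq_nonneg _
    have e2 : ∫ x, ‖Y x‖ ^ (2 : ℝ≥0∞).toReal ∂μ = ∫ x, Y x ^ 2 ∂μ := by
      congr 1; ext x; simp
    rw [hX, e1, e2, ← ENNReal.ofReal_mul (by positivity)]
    congr 1
    simp only [ENNReal.toReal_ofNat]
    rw [← Real.rpow_add' hI (by norm_num)]
    norm_num
  have h4 : ENNReal.ofReal B * (X * X) ≤ ENNReal.ofReal A * (S * eLpNorm c n μ) * (X * X) := by
    rw [← h3, ← ENNReal.ofReal_mul hB.le]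
    refine (ENNReal.ofReal_le_ofReal hen).trans ?_
    rw [ENNReal.ofReal_mul hA, h3]
    calc _ ≤ ENNReal.ofReal A * (S * eLpNorm c n μ * X * X) := by gcongr
      _ = _ := by ring
  by_contra hX0
  have h5 : X * X ≠ 0 := mul_ne_zero hX0 hX0
  have h6 : X * X ≠ ⊤ := ENNReal.mul_ne_top hXt hXt
  exact absurd ((ENNReal.mul_le_mul_iff_left h5 h6).1 h4) (not_le.2 hsmall)

end Comparison

/-! ### The comparison principle. -/

section MainComparison

variable {N : ℕ} {Ω : Set (RN N)}

theorem MemLpLoc.congr_ae {p : ℝ≥0∞} {F : Type*} [NormedAddCommGroup F] {f g : RN N → F}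
    (h : MemLpLoc Ω p f) (hfg : f =ᵐ[volume.restrict Ω] g) : MemLpLoc Ω p g := fun K hK hKΩ =>
  (h K hK hKΩ).ae_eq (ae_restrict_of_ae_restrict_of_subset hKΩ hfg)

/-- Comparison principle for a lower and an upper solution ordered on the boundary. -/
theorem le_of_isLowerSolution_of_isUpperSolution (hN : 3 ≤ N) (hΩo : IsOpen Ω)
    (hΩb : Bornology.IsBounded Ω)
    {a : Fin N → Fin N → RN N → ℝ} {H : RN N → ℝ → RN N → ℝ} {h : RN N → ℝ}
    (hL : ConditionL Ω a) (hH2 : ConditionH2 Ω H) {u₁ u₂ : RN N → ℝ}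
    (hu₁ : MemH1 Ω u₁) (hu₁N : MemW1pLoc Ω (N : ℝ≥0∞) u₁) (hu₁c : ContinuousOn u₁ (closure Ω))
    (hu₂ : MemH1 Ω u₂) (hu₂N : MemW1pLoc Ω (N : ℝ≥0∞) u₂) (hu₂c : ContinuousOn u₂ (closure Ω))
    (hlow : IsLowerSolution Ω a H h u₁) (hupp : IsUpperSolution Ω a H h u₂)
    (hbd : ∀ x ∈ frontier Ω, u₁ x ≤ u₂ x) : ∀ x ∈ Ω, u₁ x ≤ u₂ x := by
  by_contra! hcon
  obtain ⟨z, hzΩ, hz⟩ := hcon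
  have hcl : IsCompact (closure Ω) := hΩb.isCompact_closure
  have hfin : volume Ω ≠ ⊤ := hΩb.measure_lt_top.ne
  have : IsFiniteMeasure (volume.restrict Ω) := isFiniteMeasure_restrict.2 hfin
  have hmΩ := ae_restrict_mem (μ := (volume : Measure (RN N))) hΩo.measurableSet
  -- the gradients
  obtain ⟨G₁, hG₁, I₁⟩ := hlow.ineq
  obtain ⟨G₂, hG₂, I₂⟩ := hupp.ineq
  obtain ⟨hu₁L, G₁', hG₁', hG₁L⟩ := hu₁
  obtain ⟨hu₂L, G₂', hG₂', hG₂L⟩ := hu₂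
  -- By uniqueness, the gradients in the integral inequalities inherit both the `L²` and the
  -- `L^N_loc` bounds.
  replace hG₁L := hG₁L.ae_eq (hG₁'.ae_eq hΩo hG₁)
  replace hG₂L := hG₂L.ae_eq (hG₂'.ae_eq hΩo hG₂)
  obtain ⟨-, G₁'', hG₁'', hG₁N⟩ := hu₁N
  obtain ⟨-, G₂'', hG₂'', hG₂N⟩ := hu₂N
  replace hG₁N := hG₁N.congr_ae (hG₁''.ae_eq hΩo hG₁)
  replace hG₂N := hG₂N.congr_ae (hG₂''.ae_eq hΩo hG₂)
  set w : RN N → ℝ := fun x => u₁ x - u₂ x with hw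
  set G : RN N → RN N := fun x => G₁ x - G₂ x with hGdef
  have hwG : HasWeakGrad Ω w G := hG₁.sub hG₂
  have hwL : MemLp w 2 (volume.restrict Ω) := hu₁L.sub hu₂L
  have hGL : MemLp G 2 (volume.restrict Ω) := hG₁L.sub hG₂L
  have hwc : ContinuousOn w (closure Ω) := hu₁c.sub hu₂c
  -- bounds
  obtain ⟨R₁, hR₁⟩ := hcl.exists_bound_of_continuousOn hu₁c
  obtain ⟨R₂, hR₂⟩ := hcl.exists_bound_of_continuousOn hu₂c
  obtain ⟨R, hR⟩ := hcl.exists_bound_of_continuousOn hwc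
  obtain ⟨η, hη, hell⟩ := hL.elliptic
  obtain ⟨b₂, C₂, hb₂, hC₂, hH⟩ := hH2
  obtain ⟨C₀, hC₀⟩ := (isCompact_Icc.prod isCompact_Icc).exists_bound_of_continuousOn
    (hC₂.mono (prod_mono (Icc_subset_Ici_self : Icc 0 R₁ ⊆ _)
      (Icc_subset_Ici_self : Icc 0 R₂ ⊆ _)))
  replace hC₀ : ∀ x ∈ Ω, ‖C₂ |u₁ x| |u₂ x|‖ ≤ C₀ := fun x hx =>
    hC₀ (|u₁ x|, |u₂ x|) ⟨⟨abs_nonneg _, hR₁ x (subset_closure hx)⟩,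
      ⟨abs_nonneg _, hR₂ x (subset_closure hx)⟩⟩
  have hC₀0 : 0 ≤ C₀ := (norm_nonneg _).trans (hC₀ z hzΩ)
  -- the maximum of `w`
  obtain ⟨xM, hxM, hmax⟩ := hcl.exists_isMaxOn ⟨z, subset_closure hzΩ⟩ hwc
  set M := w xM with hM
  have hwM : ∀ x ∈ Ω, w x ≤ M := fun x hx => hmax (subset_closure hx)
  have hM0 : 0 < M := lt_of_lt_of_le (sub_pos.2 hz) (hwM z hzΩ)
  have hΩ_of : ∀ x ∈ closure Ω, 0 < w x → x ∈ Ω := by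
    intro x hx hpos
    by_contra hxΩ
    have := hbd x ⟨hx, fun h' => hxΩ (interior_subset h')⟩
    simp only [hw] at hpos
    linarith
  have hxMΩ : xM ∈ Ω := hΩ_of xM hxM hM0
  set K : Set (RN N) := closure Ω ∩ w ⁻¹' Ici (M / 2) with hKdef
  have hK : IsCompact K :=
    hcl.of_isClosed_subset (hwc.preimage_isClosed_of_isClosed isClosed_closure isClosed_Ici)
      inter_subset_left
  have hKΩ : K ⊆ Ω := fun x hx => hΩ_of x hx.1 (lt_of_lt_of_le (by positivity) hx.2)
  have hKk : ∀ k, M / 2 ≤ k → ∀ x ∈ Ω, k < w x → x ∈ K := fun k hk x hx hxk =>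
    ⟨subset_closure hx, hk.trans hxk.le⟩
  set c : RN N → ℝ := fun x => ‖G₁ x‖ + ‖G₂ x‖ + |b₂ x| with hc
  have hcK : MemLp c N (volume.restrict K) :=
    ((hG₁N K hK hKΩ).norm.add (hG₂N K hK hKΩ).norm).add (hb₂ K hK hKΩ).norm
  -- exponents
  have hN3 : (3 : ℝ) ≤ N := by exact_mod_cast hN
  have hNinv : (N : ℝ)⁻¹ < 2⁻¹ := inv_strictAnti₀ (by norm_num) (by linarith)
  -- The Sobolev exponent `2N / (N - 2)`, positive and finite since `N > 2`.
  set q : NNReal := (2⁻¹ - (N : ℝ)⁻¹).toNNReal⁻¹ with hq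
  have hq1 : (q : ℝ)⁻¹ = 2⁻¹ - (N : ℝ)⁻¹ := by
    rw [hq, NNReal.coe_inv, inv_inv, Real.coe_toNNReal _ (by linarith)]
  have hq0 : q ≠ 0 := by
    intro h0
    rw [h0] at hq1
    simp only [NNReal.coe_zero, inv_zero] at hq1
    linarith
  have hholder : ENNReal.HolderTriple (q : ℝ≥0∞) (N : ℝ≥0∞) 2 := by
    refine ⟨?_⟩
    have hN0 : (N : NNReal) ≠ 0 := by
      have : N ≠ 0 := by omega
      exact_mod_cast this
    have e : (q : NNReal)⁻¹ + (N : NNReal)⁻¹ = 2⁻¹ := by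
      apply NNReal.coe_injective
      push_cast
      rw [hq1]; ring
    have e2 := congrArg ENNReal.ofNNReal e
    rw [ENNReal.coe_add, ENNReal.coe_inv hq0, ENNReal.coe_inv hN0,
      ENNReal.coe_inv two_ne_zero] at e2
    simpa using e2
  set S : ℝ≥0∞ := ENNReal.ofNNReal (SNormLESNormFDerivOfEqConst ℝ (volume : Measure (RN N)) 2)
    with hS
  -- the level
  obtain ⟨k, hk1, hkM, hsmall⟩ := exists_level_eLpNorm_indicator_lt hΩo hfin
    (hwc.mono subset_closure) (half_lt_self hM0) (hKk _ le_rfl) (p := (N : ℝ≥0∞))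
    (by exact_mod_cast (by omega : 1 ≤ N)) (ENNReal.natCast_ne_top N) hcK
    (ε := ENNReal.ofReal (3 / 4 * η) / (ENNReal.ofReal (C₀ / 2) * S + 1))
    (ENNReal.div_pos (ENNReal.ofReal_pos.2 (by positivity)).ne' (by
      simp [hS, ENNReal.mul_eq_top]))
  have hk0 : 0 < k := lt_trans (by positivity) hk1
  set E := Ω ∩ w ⁻¹' Ioo k M with hE
  have hEo : IsOpen E := (hwc.mono subset_closure).isOpen_inter_preimage hΩo isOpen_Ioo
  set cE := E.indicator c with hcE
  have hcEL : MemLp cE N (volume.restrict Ω) := by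
    rw [hcE, memLp_indicator_iff_restrict hEo.measurableSet,
      Measure.restrict_restrict hEo.measurableSet, inter_eq_left.2 inter_subset_left]
    exact hcK.mono_measure (Measure.restrict_mono (fun x hx => hKk k hk1.le x hx.1 hx.2.1) le_rfl)
  replace hsmall : ENNReal.ofReal (C₀ / 2) * (S * eLpNorm cE N (volume.restrict Ω))
      < ENNReal.ofReal (3 / 4 * η) := by
    have h1 := ENNReal.mul_lt_of_lt_div hsmall
    refine lt_of_le_of_lt ?_ h1
    rw [← mul_assoc, mul_comm (eLpNorm _ _ _)]
    gcongr
    exact le_self_add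
  -- the truncations
  set s : RN N → ℝ := fun x => max (w x - k) 0 with hs
  have hs0 : ∀ x, 0 ≤ s x := fun x => le_max_right _ _
  -- Index `0` gives `V = s²`, to which Sobolev is applied; index `1` gives the test function `s³`.
  obtain ⟨-, hVtop, hVG, φV, hφV⟩ := hwG.max_sub_pow hΩo hwL hGL
    (fun x hx => hR x (subset_closure hx)) hK hKΩ (hKk k hk1.le) 0
  obtain ⟨hφG, hφtop, hΦL, φ', hφ'⟩ := hwG.max_sub_pow hΩo hwL hGL
    (fun x hx => hR x (subset_closure hx)) hK hKΩ (hKk k hk1.le) 1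
  norm_num at hVtop hVG hφV hφG hφtop hΦL hφ'
  have hV2 : MemLp (fun x => s x ^ 2) 2 (volume.restrict Ω) := hVtop.mono_exponent le_top
  have hφH : MemH10 Ω fun x => s x ^ 3 :=
    ⟨hφtop.mono_exponent le_top, _, hφG, hΦL, φ', hφ'.test, hφ'.tendsto, hφ'.tendsto_grad⟩
  have hφ0 : ∀ᵐ x ∂(volume.restrict Ω), 0 ≤ s x ^ 3 := ae_of_all _ fun x => pow_nonneg (hs0 x) 3
  obtain ⟨J₁, T₁⟩ := I₁ _ _ hφH hφtop hφ0 hφG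
  obtain ⟨J₂, T₂⟩ := I₂ _ _ hφH hφtop hφ0 hφG
  have hlow' := elliptic_le (t := fun x => 3 * s x ^ 2) hL.bounded hell hG₁L hG₂L
    (fun x => by positivity) hΦL
  set Y : RN N → ℝ := fun x => ‖(2 * s x) • G x‖ with hY
  have hYL : MemLp Y 2 (volume.restrict Ω) := hVG.norm
  have hsob : eLpNorm (fun x => s x ^ 2) q (volume.restrict Ω)
      ≤ S * eLpNorm Y 2 (volume.restrict Ω) := by
    rw [hY, eLpNorm_norm]
    exact hφV.eLpNorm_le hΩo hV2 hVG (by omega) hq1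
  have hAL : MemLp (fun x => s x ^ 2 * cE x) 2 (volume.restrict Ω) :=
    MemLp.mul (p := ⊤) (q := (N : ℝ≥0∞)) (r := (N : ℝ≥0∞)) hcEL hVtop |>.mono_exponent (by
      exact_mod_cast (by omega : 2 ≤ N))
  have hupper : ∫ x in Ω, (H x (u₁ x) (G₁ x) * s x ^ 3 - H x (u₂ x) (G₂ x) * s x ^ 3)
      ≤ ∫ x in Ω, C₀ / 2 * (s x ^ 2 * cE x * Y x) := by
    refine integral_mono_ae (J₁.sub J₂) ((hAL.integrable_mul hYL).const_mul _) ?_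
    -- Three regions: `s = 0` where `w ≤ k`, (H2) on the strip, and `∇w = 0` on `{w = M}`. In the
    -- last one (H2) still gives an upper bound, which is then zero.
    filter_upwards [hH, hmΩ, hwG.ae_eq_zero_of_eq hΩo hwL hGL M] with x hHx hxΩ hlev
    by_cases hxk : w x ≤ k
    · have : s x = 0 := max_eq_right (by linarith)
      simp [this]
    push Not at hxk
    have hsx : s x = w x - k := max_eq_left (by linarith)
    have hu : u₂ x ≤ u₁ x := by
      have : 0 < w x := hk0.trans hxk
      simp only [hw] at this
      linarith
    have h1 := hHx (u₁ x) (u₂ x) hu (G₁ x) (G₂ x)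
    have h2 : H x (u₁ x) (G₁ x) * s x ^ 3 - H x (u₂ x) (G₂ x) * s x ^ 3
        ≤ C₂ |u₁ x| |u₂ x| * (‖G₁ x‖ + ‖G₂ x‖ + b₂ x) * ‖G x‖ * s x ^ 3 := by
      rw [← sub_mul]
      exact mul_le_mul_of_nonneg_right h1 (pow_nonneg (hs0 x) 3)
    refine h2.trans ?_
    have hYx : Y x = 2 * s x * ‖G x‖ := by
      simp only [hY]
      rw [norm_smul, Real.norm_of_nonneg (by linarith [hs0 x])]
    rcases (hwM x hxΩ).lt_or_eq with hlt | heq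
    · have hcx : cE x = c x := indicator_of_mem (show x ∈ E from ⟨hxΩ, hxk, hlt⟩) c
      have h3 : C₂ |u₁ x| |u₂ x| * (‖G₁ x‖ + ‖G₂ x‖ + b₂ x) ≤ C₀ * c x := by
        refine (le_abs_self _).trans ?_
        rw [abs_mul]
        refine mul_le_mul (hC₀ x hxΩ) ?_ (abs_nonneg _) hC₀0
        refine (abs_add_le _ _).trans ?_
        rw [abs_of_nonneg (by positivity)]
      calc _ ≤ C₀ * c x * ‖G x‖ * s x ^ 3 := by
            have := hs0 x
            gcongr
        _ = C₀ / 2 * (s x ^ 2 * cE x * Y x) := by rw [hcx, hYx]; ring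
    · have hG0 : G x = 0 := hlev heq
      rw [hYx, hG0]
      simp
  have henergy : 3 / 4 * η * ∫ x in Ω, Y x ^ 2 ≤
      C₀ / 2 * ∫ x in Ω, s x ^ 2 * cE x * Y x := by
    rw [← integral_const_mul, ← integral_const_mul]
    -- Since `Y = 2 s |∇w|`, the energy density `3 s² |∇w|²` equals `(3/4) Y²`.
    refine le_trans (le_of_eq ?_) (hlow'.trans (le_trans ?_ hupper))
    · congr 1; ext x
      simp only [hY]
      rw [norm_smul, Real.norm_of_nonneg (by linarith [hs0 x])]
      ring
    -- Subtracting the upper from the lower inequality cancels the common term in `h`.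
    · rw [integral_sub J₁ J₂]
      linarith
  have hX := eLpNorm_eq_zero_of_energy_le (S := S) (by positivity) hV2.1 hcEL.1 hYL hsob hsmall
    henergy (by positivity)
  rw [hX, mul_zero] at hsob
  have hV0 := (eLpNorm_eq_zero_iff hV2.1 (by simpa using hq0)).1 (le_antisymm hsob zero_le)
  have hUo : IsOpen (Ω ∩ w ⁻¹' Ioi k) :=
    (hwc.mono subset_closure).isOpen_inter_preimage hΩo isOpen_Ioi
  have hpos := hUo.measure_pos volume ⟨xM, hxMΩ, hkM⟩
  -- Now `s = 0` a.e. in `Ω`, but `s > 0` on an open neighbourhood of the maximum point `xM`.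
  refine hpos.ne' (measure_mono_null (fun x hx => ?_) ((ae_restrict_iff' hΩo.measurableSet).1 hV0))
  intro hx0
  have h1 : s x ^ 2 = 0 := hx0 hx.1
  have h2 : 0 < s x := lt_max_of_lt_left (sub_pos.2 hx.2)
  exact (pow_pos h2 2).ne' h1

end MainComparison

theorem lemma2p5 (N : ℕ) (hN : 3 ≤ N) (Ω : Set (RN N)) (hΩo : IsOpen Ω) (hΩc : IsConnected Ω)
    (hΩb : Bornology.IsBounded Ω)
    (a : Fin N → Fin N → RN N → ℝ) (H : RN N → ℝ → RN N → ℝ) (h : RN N → ℝ)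
    (p : ℝ≥0∞) (hp : (N : ℝ≥0∞) / 2 < p) (hh : MemLp h p (volume.restrict Ω))
    (hH : IsCaratheodory Ω H) (hL : ConditionL Ω a) (hH2 : ConditionH2 Ω H)
    (u₁ u₂ : RN N → ℝ)
    (hu₁ : MemH1 Ω u₁) (hu₁N : MemW1pLoc Ω (N : ℝ≥0∞) u₁) (hu₁c : ContinuousOn u₁ (closure Ω))
    (hu₂ : MemH1 Ω u₂) (hu₂N : MemW1pLoc Ω (N : ℝ≥0∞) u₂) (hu₂c : ContinuousOn u₂ (closure Ω))
    (hlow : IsLowerSolution Ω a H h u₁) (hupp : IsUpperSolution Ω a H h u₂)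
    (hbd : ConditionA Ω ∨ ∀ x ∈ frontier Ω, u₁ x ≤ u₂ x) :
    ∀ x ∈ Ω, u₁ x ≤ u₂ x := by
  refine le_of_isLowerSolution_of_isUpperSolution hN hΩo hΩb hL hH2 hu₁ hu₁N hu₁c hu₂ hu₂N hu₂c
    hlow hupp ?_
  rcases hbd with hA | hbd
  · intro x hx
    -- On the boundary `u₁ ≤ u₁⁺ ≤ 0` and `-u₂ ≤ u₂⁻ ≤ 0`, whence the ordering.
    have h1 := hlow.posPart.nonpos_of_conditionA hΩo hA (hu₁c.sup continuousOn_const) x hx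
    have h2 := hupp.negPart.nonpos_of_conditionA hΩo hA (hu₂c.neg.sup continuousOn_const) x hx
    linarith [le_max_left (u₁ x) 0, le_max_left (-u₂ x) 0]
  · exact hbd
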